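/- Let $v\in(0,1)$ (the parameter of the vacuum $\lambda$-$R$ models, $v=1/\sqrt{2(3\lambda-1)}$). The Bianchi type $\mathrm{VII}_0$ vacuum $\lambda$-$R$ models with $N_1=0$ are described by the dynamical system, with time $\tau_-$, $$\Sigma_+'=2(1-\Sigma^2)(1+2v\Sigma_+),\qquad \Sigma_-'=4v(1-\Sigma^2)\Sigma_-+2\sqrt3\,(N_2^2-N_3^2),$$ $$N_2'=-2(2v\Sigma^2+\Sigma_++\sqrt3\,\Sigma_-)N_2,\qquad N_3'=-2(2v\Sigma^2+\Sigma_+-\sqrt3\,\Sigma_-)N_3,$$ where $\Sigma^2:=\Sigma_+^2+\Sigma_-^2$, on the invariant state space of all $(\Sigma_+,\Sigma_-,N_2,N_3)\in\mathbb R^4$ with $N_2>0$, $N_3>0$ and $1-\Sigma^2-(N_2-N_3)^2=0$. Orbits are those of solutions defined for all $\tau_-\in\mathbb R$, and the $\alpha$-limit set of an orbit is the set of all its limit points as $\tau_-\to-\infty$. Put $N_\pm:=N_2\pm N_3$ and $$\mathrm{LRS}^\pm:=\{\Sigma_+=\pm1,\ \Sigma_-=0,\ N_2=N_3>0\},\qquad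 N:=N_2=N_3\ \text{ on } \mathrm{LRS}^\pm .$$ An orbit is non-$\mathrm{LRS}^+$ if it is not contained in $\mathrm{LRS}^+$, and non-$\mathrm{LRS}$ if it is not contained in $\mathrm{LRS}^+\cup\mathrm{LRS}^-$. Let $\mathrm K^{\circ}:=\{\Sigma^2=1,\ N_2=N_3=0\}$ be the Kasner circle, with the arcs $A_2:=\{p\in\mathrm K^{\circ}:\Sigma_++\sqrt3\,\Sigma_-\le-2v\}$ and $A_3:=\{p\in\mathrm K^{\circ}:\Sigma_+-\sqrt3\,\Sigma_-\le-2v\}$. Then the following holds. (i) If $v\in(0,1/2)$, the $\alpha$-limit set of every non-$\mathrm{LRS}^+$ orbit is non-empty and contained in $A_2\cap A_3$. The set $\mathrm{LRS}^+$ consists of one orbit, along which $\lim_{\tau_-\to-\infty}N=\infty$. (ii) If $v=1/2$, the set $\mathrm{LRS}^-$ is a line of fixed points, and the $\alpha$-limit set of every non-$\mathrm{LRS}$ orbit is non-empty and contained in $\mathrm{LRS}^-$. The set $\mathrm{LRS}^+$ consists of one orbit, along which $\lim_{\tau_-\to-\infty}N=\infty$. (iii) If $v\in(1/2,1)$, every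 non-$\mathrm{LRS}$ orbit satisfies $$\lim_{\tau_-\to-\infty}\Sigma_+=-\frac1{2v},\qquad \lim_{\tau_-\to-\infty}N_+=\infty,$$ whereas $\Sigma_-$ and $N_-$ oscillate: each takes both positive and negative values at arbitrarily early times. More precisely, $(\Sigma_-,N_-)=\bigl(\sqrt{1-\Sigma_+^2}\cos\psi,\ \sqrt{1-\Sigma_+^2}\sin\psi\bigr)$ along the orbit for a continuous function $\psi$ of $\tau_-$, and each such $\psi$ is strictly decreasing in $\tau_-$ on some interval $(-\infty,T]$ and tends to $+\infty$ as $\tau_-\to-\infty$. Each of the two sets $\mathrm{LRS}^\pm$ consists of one orbit, along which $\lim_{\tau_-\to-\infty}N=\infty$. -/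

import Mathlib

open Real Set Filter Topology

noncomputable section

namespace LambdaR

/-- A state `(Σ₊, Σ₋, N₂, N₃)` of the vacuum `λ`-`R` models with `N₁ = 0`. -/
abbrev State := Fin 4 → ℝ

namespace State

/-- The Misner variable `Σ₊`. -/
def sigmaPlus (p : State) : ℝ := p 0

/-- The Misner variable `Σ₋`. -/
def sigmaMinus (p : State) : ℝ := p 1

/-- The variable `N₂`. -/
def n2 (p : State) : ℝ := p 2

/-- The variable `N₃`. -/
def n3 (p : State) : ℝ := p 3

/-- `Σ² = Σ₊² + Σ₋²`. -/
def sigmaSq (p : State) : ℝ := p.sigmaPlus ^ 2 + p.sigmaMinus ^ 2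

/-- The shear variable `Σ₂ = Σ₊ + √3 Σ₋`. -/
def sigma2 (p : State) : ℝ := p.sigmaPlus + √3 * p.sigmaMinus

/-- The shear variable `Σ₃ = Σ₊ - √3 Σ₋`. -/
def sigma3 (p : State) : ℝ := p.sigmaPlus - √3 * p.sigmaMinus

/-- `N₊ = N₂ + N₃`. -/
def nPlus (p : State) : ℝ := p.n2 + p.n3

/-- `N₋ = N₂ - N₃`. -/
def nMinus (p : State) : ℝ := p.n2 - p.n3

end State

/-- The right-hand side of the evolution equations (in the time `τ₋`) when `N₁ = 0`. -/
def field (v : ℝ) (p : State) : State :=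
  ![2 * (1 - p.sigmaSq) * (1 + 2 * v * p.sigmaPlus),
    4 * v * (1 - p.sigmaSq) * p.sigmaMinus + 2 * √3 * (p.n2 ^ 2 - p.n3 ^ 2),
    -2 * (2 * v * p.sigmaSq + p.sigmaPlus + √3 * p.sigmaMinus) * p.n2,
    -2 * (2 * v * p.sigmaSq + p.sigmaPlus - √3 * p.sigmaMinus) * p.n3]

/-- The Bianchi type `VII₀` state space: `N₂, N₃ > 0` and the constraint. -/
def typeVII0 : Set State :=
  {p | 0 < p.n2 ∧ 0 < p.n3 ∧ 1 - p.sigmaSq - (p.n2 - p.n3) ^ 2 = 0}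

/-- `x` is a type `VII₀` solution, with time `τ₋ ∈ ℝ`. Its orbit is `range x`. -/
structure IsSolution (v : ℝ) (x : ℝ → State) : Prop where
  mem : ∀ t, x t ∈ typeVII0
  hasDerivAt : ∀ t, HasDerivAt x (field v (x t)) t

/-- The `α`-limit set: all limits of `x (tₙ)` along times `tₙ → -∞`. -/
def alphaLimit (x : ℝ → State) : Set State :=
  {p | ∃ t : ℕ → ℝ, Tendsto t atTop atBot ∧ Tendsto (fun n => x (t n)) atTop (𝓝 p)}

/-- The Kasner circle of fixed points. -/
def kasnerCircle : Set State :=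
  {p | p.sigmaSq = 1 ∧ p.n2 = 0 ∧ p.n3 = 0}

/-- The closed Kasner arc `A₂`. -/
def arcA2 (v : ℝ) : Set State := {p ∈ kasnerCircle | p.sigma2 ≤ -2 * v}

/-- The closed Kasner arc `A₃`. -/
def arcA3 (v : ℝ) : Set State := {p ∈ kasnerCircle | p.sigma3 ≤ -2 * v}

/-- The set `LRS⁺` in the type `VII₀` state space. -/
def lrsPlus : Set State :=
  {p | p.sigmaPlus = 1 ∧ p.sigmaMinus = 0 ∧ p.n2 = p.n3 ∧ 0 < p.n2}

/-- The set `LRS⁻` in the type `VII₀` state space. -/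
def lrsMinus : Set State :=
  {p | p.sigmaPlus = -1 ∧ p.sigmaMinus = 0 ∧ p.n2 = p.n3 ∧ 0 < p.n2}

/-- `S` is a single orbit, and each of its parametrizations as a solution satisfies
`N₂ → ∞` as `τ₋ → -∞`. It is used for the LRS sets, where `N = N₂ = N₃`. -/
def IsOrbitWithPastUnboundedN (v : ℝ) (S : Set State) : Prop :=
  (∃ x, IsSolution v x ∧ range x = S) ∧
  ∀ x, IsSolution v x → x 0 ∈ S →
    range x = S ∧ Tendsto (fun t => (x t).n2) atBot atTop

/-- `f` takes positive and negative values at arbitrarily early times. -/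
def OscillatesInPast (f : ℝ → ℝ) : Prop :=
  (∃ᶠ t in atBot, 0 < f t) ∧ ∃ᶠ t in atBot, f t < 0

/-- `ψ` is a continuous choice of polar angle of `(Σ₋, N₋)` along `x`. -/
structure IsPolarAngle (x : ℝ → State) (ψ : ℝ → ℝ) : Prop where
  continuous : Continuous ψ
  sigmaMinus_eq : ∀ t, (x t).sigmaMinus = √(1 - (x t).sigmaPlus ^ 2) * cos (ψ t)
  nMinus_eq : ∀ t, (x t).nMinus = √(1 - (x t).sigmaPlus ^ 2) * sin (ψ t)

end LambdaR

end

/-! Two exact derivatives drive the proof. By `hasDerivAt_log_sq`, `N₋²` is up to the factor `8v`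
the derivative of `log ((1 + 2vΣ₊)²)`. By `hasDerivAt_crossRatio`, the bounded quantity `u =
Σ₋N₋/N₊` has derivative `2√3(N₋² - Σ₋²)` plus corrections in `u`, so `N₋²` and `Σ₋²` have nearly
equal time averages when `N₊` is not small. Together they give `false_of_averaging`: while `N₊`
stays away from zero, `Σ₊` must approach `±1` or `-1/(2v)` towards the past.

What remains is to control `N₂N₃`. For `v < 1/2`, averaging forces `Σ₊ < -2v` at some time; then
`N₂N₃ → 0`, a Barbălat argument gives `N₋ → 0`, and the solution converges to a Kasner point, which
lies on both arcs because `N₂` and `N₃` decay towards the past.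

For `v ≥ 1/2`, subtracting a multiple of `u` from `log (N₂N₃)` replaces `N₋²` by its average and
leaves a derivative of one sign (`deriv_log_nProd_sub_crossRatio_le`). At `v = 1/2` this gives a
lower bound on `N₂N₃`, hence `Σ₊ → -1`; a second corrected functional gives an upper bound
(`exists_nProd_le`). For `v > 1/2` it gives `N₂N₃ → ∞`, hence `Σ₊ → -1/(2v)`, and the angular
velocity of `(Σ₋, N₋)` is dominated by `-2√3 N₊`. -/

namespace LambdaR

/-! ### Calculus towards the past -/

section Calculus

/-- A function whose derivative is at most `-ε` grows at least linearly towards the past. -/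
theorem linear_growth_of_deriv_le {f f' : ℝ → ℝ} {T ε : ℝ}
    (hf : ∀ t ≤ T, HasDerivAt f (f' t) t) (hle : ∀ t ≤ T, f' t ≤ -ε) {t : ℝ} (ht : t ≤ T) :
    f T + ε * (T - t) ≤ f t := by
  have h : AntitoneOn (fun s => f s + ε * s) (Iic T) := by
    have hd : ∀ s ≤ T, HasDerivAt (fun s => f s + ε * s) (f' s + ε * 1) s := fun s hs =>
      (hf s hs).add ((hasDerivAt_id s).const_mul ε)
    refine antitoneOn_of_deriv_nonpos (convex_Iic T)
      (fun s hs => (hd s hs).continuousAt.continuousWithinAt)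
      (fun s hs => ?_) (fun s hs => ?_) <;> rw [interior_Iic] at hs
    · exact (hd s hs.le).differentiableAt.differentiableWithinAt
    · rw [(hd s hs.le).deriv]
      linarith [hle s hs.le]
  have := h (mem_Iic.2 ht) self_mem_Iic ht
  simp only at this
  linarith

theorem le_of_deriv_nonneg {f f' : ℝ → ℝ} {T : ℝ}
    (hf : ∀ t ≤ T, HasDerivAt f (f' t) t) (hle : ∀ t ≤ T, 0 ≤ f' t) {t : ℝ} (ht : t ≤ T) :
    f t ≤ f T := by
  have := linear_growth_of_deriv_le (f := fun t => -f t) (ε := 0) (fun t ht => (hf t ht).neg)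
    (fun t ht => by simpa using hle t ht) ht
  linarith

theorem le_of_deriv_nonpos {f f' : ℝ → ℝ} {T : ℝ}
    (hf : ∀ t ≤ T, HasDerivAt f (f' t) t) (hle : ∀ t ≤ T, f' t ≤ 0) {t : ℝ} (ht : t ≤ T) :
    f T ≤ f t := by
  have := linear_growth_of_deriv_le (ε := 0) hf (fun t ht => by simpa using hle t ht) ht
  linarith

theorem tendsto_linear_atBot {ε : ℝ} (hε : 0 < ε) (c T : ℝ) :
    Tendsto (fun t => c + ε * (T - t)) atBot atTop :=
  tendsto_atTop_add_const_left _ _ <| Tendsto.const_mul_atTop hε <|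
    tendsto_atTop_add_const_left _ _ tendsto_neg_atBot_atTop

theorem tendsto_atTop_of_deriv_le {f f' : ℝ → ℝ} {T ε : ℝ} (hε : 0 < ε)
    (hf : ∀ t ≤ T, HasDerivAt f (f' t) t) (hle : ∀ t ≤ T, f' t ≤ -ε) :
    Tendsto f atBot atTop := by
  refine tendsto_atTop_mono' _ ?_ (tendsto_linear_atBot hε (f T) T)
  filter_upwards [eventually_le_atBot T] with t ht
  exact linear_growth_of_deriv_le hf hle ht

/-- A bounded function cannot have a derivative which is at most `-ε` at all early times. -/
theorem false_of_deriv_le {f f' : ℝ → ℝ} {T ε B : ℝ} (hε : 0 < ε)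
    (hf : ∀ t ≤ T, HasDerivAt f (f' t) t) (hle : ∀ t ≤ T, f' t ≤ -ε)
    (hB : ∀ t ≤ T, f t ≤ B) : False := by
  obtain ⟨t, ht, hBt⟩ := ((eventually_le_atBot T).and
    ((tendsto_atTop_of_deriv_le hε hf hle).eventually_gt_atTop B)).exists
  exact (hB t ht).not_gt hBt

/-- Grönwall uniqueness for a non-negative function with `|f'| ≤ K f`. -/
theorem eq_zero_of_abs_deriv_le {f f' : ℝ → ℝ} {K t₀ : ℝ} (hf : ∀ t, HasDerivAt f (f' t) t)
    (h0 : ∀ t, 0 ≤ f t) (hK : ∀ t, |f' t| ≤ K * f t) (ht₀ : f t₀ = 0) (t : ℝ) : f t = 0 := by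
  -- The integrating factor is used with `c = K` before `t₀` and with `c = -K` after it.
  have key : ∀ c : ℝ, ∀ s, HasDerivAt (fun s => f s * exp (c * s))
      ((f' s + c * f s) * exp (c * s)) s := fun c s => by
    refine ((hf s).mul (((hasDerivAt_id s).const_mul c).exp)).congr_deriv ?_
    simp only [id]
    ring
  refine le_antisymm ?_ (h0 t)
  rcases le_total t t₀ with h | h
  · have := le_of_deriv_nonneg (T := t₀) (fun s _ => key K s) (fun s _ => mul_nonneg
      (by linarith [abs_le.1 (hK s)]) (exp_pos _).le) h
    simp only [ht₀, zero_mul] at this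
    exact nonpos_of_mul_nonpos_left this (exp_pos _)
  · have := le_of_deriv_nonpos (T := t) (fun s _ => key (-K) s) (fun s _ =>
      mul_nonpos_of_nonpos_of_nonneg (by linarith [abs_le.1 (hK s)]) (exp_pos _).le) h
    simp only [ht₀, zero_mul] at this
    exact nonpos_of_mul_nonpos_left this (exp_pos _)

/-- A continuous function without zeros at early times has constant sign there. -/
theorem pos_or_neg_of_ne_zero {f : ℝ → ℝ} (hf : Continuous f) {T : ℝ} (h : ∀ t ≤ T, f t ≠ 0) :
    (∀ t ≤ T, 0 < f t) ∨ ∀ t ≤ T, f t < 0 := by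
  by_contra! hcon
  obtain ⟨⟨a, ha, ha0⟩, b, hb, hb0⟩ := hcon
  obtain ⟨c, hc, hc0⟩ := (isPreconnected_Iic (a := T)).intermediate_value (mem_Iic.2 ha)
    (mem_Iic.2 hb) hf.continuousOn ⟨ha0, hb0⟩
  exact h c hc hc0

/-- If `ℓ > 0`, continuity fixes the sign of `f` at early times, so `f` cannot jump between `√ℓ` and
`-√ℓ`. -/
theorem exists_tendsto_of_tendsto_sq {f : ℝ → ℝ} (hf : Continuous f) {ℓ : ℝ}
    (h : Tendsto (fun t => f t ^ 2) atBot (𝓝 ℓ)) : ∃ y, Tendsto f atBot (𝓝 y) := by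
  have habs : Tendsto (fun t => |f t|) atBot (𝓝 √ℓ) := by
    simpa only [sqrt_sq_eq_abs] using h.sqrt
  rcases (ge_of_tendsto' h fun t => sq_nonneg (f t)).eq_or_lt with h0 | h0
  · rw [← h0, sqrt_zero] at habs
    exact ⟨0, (tendsto_zero_iff_abs_tendsto_zero _).2 habs⟩
  · obtain ⟨T, hT⟩ := eventually_atBot.1 (h.eventually_const_lt h0)
    rcases pos_or_neg_of_ne_zero hf fun t ht h0 => by simpa [h0] using hT t ht with hs | hs
    · refine ⟨_, habs.congr' ?_⟩
      filter_upwards [eventually_le_atBot T] with t ht using abs_of_pos (hs t ht)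
    · refine ⟨_, habs.neg.congr' ?_⟩
      filter_upwards [eventually_le_atBot T] with t ht
      rw [abs_of_neg (hs t ht), neg_neg]

/-- Barbălat's lemma towards the past: if `f` converges and its non-negative derivative has
bounded derivative, then the derivative tends to zero. -/
theorem tendsto_deriv_zero_of_tendsto {f g g' : ℝ → ℝ} {T C ℓ : ℝ} (hC : 0 < C)
    (hf : ∀ t, HasDerivAt f (g t) t) (hg : ∀ t, HasDerivAt g (g' t) t) (h0 : ∀ t, 0 ≤ g t)
    (hb : ∀ t ≤ T, -C ≤ g' t) (hl : Tendsto f atBot (𝓝 ℓ)) : Tendsto g atBot (𝓝 0) := by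
  have hslope : ∀ t s, t ≤ s → s ≤ T → g t - C * (s - t) ≤ g s := fun t s hts hs => by
    have := le_of_deriv_nonneg (f := fun r => g r + C * r) (T := s)
      (fun r _ => (hg r).add ((hasDerivAt_id r).const_mul C))
      (fun r hr => by linarith [hb r (hr.trans hs)]) hts
    linarith
  have hquad : ∀ t s, t ≤ s → s ≤ T → g t * (s - t) - C * (s - t) ^ 2 ≤ f s - f t := by
    intro t s hts hs
    have hd : ∀ r, HasDerivAt (fun r => f r - (g t * (r - t) - C * (r - t) ^ 2))
        (g r - (g t * 1 - C * (2 * (r - t) ^ 1 * 1))) r := fun r =>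
      (hf r).sub ((((hasDerivAt_id r).sub_const t).const_mul _).sub
        ((((hasDerivAt_id r).sub_const t).pow 2).const_mul _))
    have hmono : MonotoneOn (fun r => f r - (g t * (r - t) - C * (r - t) ^ 2)) (Icc t s) := by
      refine monotoneOn_of_deriv_nonneg (convex_Icc t s)
        (fun r _ => (hd r).continuousAt.continuousWithinAt)
        (fun r _ => (hd r).differentiableAt.differentiableWithinAt) fun r hr => ?_
      rw [interior_Icc] at hr
      rw [(hd r).deriv]
      have := hslope t r hr.1.le (hr.2.le.trans hs)
      nlinarith [mul_pos hC (sub_pos.2 hr.1)]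
    have := hmono (left_mem_Icc.2 hts) (right_mem_Icc.2 hts) hts
    simp only [sub_self] at this
    linarith
  rw [Metric.tendsto_nhds]
  intro ε hε
  -- With step `h = ε/(2C)` the quadratic loss `C h²` in `hquad` is exactly `h ε/2`, half of what is
  -- allowed.
  have hh : 0 < ε / (2 * C) := by positivity
  have hdiff : Tendsto (fun t => f (t + ε / (2 * C)) - f t) atBot (𝓝 0) := by
    simpa using (hl.comp (tendsto_atBot_add_const_right _ _ tendsto_id)).sub hl
  filter_upwards [hdiff.eventually_lt_const (show (0 : ℝ) < ε / (2 * C) * (ε / 2) by positivity),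
    eventually_le_atBot (T - ε / (2 * C))] with t h1 h2
  rw [Real.dist_eq, sub_zero, abs_of_nonneg (h0 t)]
  have h3 := hquad t (t + ε / (2 * C)) (by linarith) (by linarith)
  have h4 : C * (t + ε / (2 * C) - t) ^ 2 = ε / (2 * C) * (ε / 2) := by field_simp; ring
  rw [h4, add_sub_cancel_left] at h3
  have : g t * (ε / (2 * C)) < ε * (ε / (2 * C)) := by linarith
  exact lt_of_mul_lt_mul_right this hh.le

end Calculus

/-! ### Auxiliary quantities and bounds on the state space -/

namespace State

/-- The product `N₂ N₃`. -/
def nProd (p : State) : ℝ := p.n2 * p.n3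

/-- The quotient `Σ₋ N₋ / N₊`. -/
noncomputable def crossRatio (p : State) : ℝ := p.sigmaMinus * p.nMinus / p.nPlus

end State

section StateSpace

variable {p : State}

theorem nPlus_pos (hp : p ∈ typeVII0) : 0 < p.nPlus := add_pos hp.1 hp.2.1

theorem nProd_pos (hp : p ∈ typeVII0) : 0 < p.nProd := mul_pos hp.1 hp.2.1

theorem constraint (hp : p ∈ typeVII0) :
    p.sigmaPlus ^ 2 + p.sigmaMinus ^ 2 + p.nMinus ^ 2 = 1 := by
  have := hp.2.2
  simp only [State.sigmaSq, State.nMinus] at *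
  linarith

theorem nPlus_sq (p : State) : p.nPlus ^ 2 = p.nMinus ^ 2 + 4 * p.nProd := by
  simp only [State.nPlus, State.nMinus, State.nProd]
  ring

theorem abs_nMinus_le (hp : p ∈ typeVII0) : |p.nMinus| ≤ p.nPlus := by
  have h1 := hp.1
  have h2 := hp.2.1
  simp only [State.nPlus, State.nMinus]
  rw [abs_le]
  constructor <;> linarith

theorem sigmaPlus_mem (hp : p ∈ typeVII0) : -1 ≤ p.sigmaPlus ∧ p.sigmaPlus ≤ 1 :=
  abs_le.1 <| abs_le_one_iff_mul_self_le_one.2 <| by nlinarith [constraint hp]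

theorem sigmaMinus_mem (hp : p ∈ typeVII0) : -1 ≤ p.sigmaMinus ∧ p.sigmaMinus ≤ 1 :=
  abs_le.1 <| abs_le_one_iff_mul_self_le_one.2 <| by nlinarith [constraint hp]

theorem nMinus_mem (hp : p ∈ typeVII0) : -1 ≤ p.nMinus ∧ p.nMinus ≤ 1 :=
  abs_le.1 <| abs_le_one_iff_mul_self_le_one.2 <| by nlinarith [constraint hp]

theorem crossRatio_mul_nPlus (hp : p ∈ typeVII0) :
    p.crossRatio * p.nPlus = p.sigmaMinus * p.nMinus :=
  div_mul_cancel₀ _ (nPlus_pos hp).ne'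

theorem abs_crossRatio_le (hp : p ∈ typeVII0) : |p.crossRatio| ≤ |p.sigmaMinus| := by
  rw [State.crossRatio, abs_div, abs_mul, abs_of_pos (nPlus_pos hp),
    div_le_iff₀ (nPlus_pos hp)]
  exact mul_le_mul_of_nonneg_left (abs_nMinus_le hp) (abs_nonneg _)

theorem crossRatio_mem (hp : p ∈ typeVII0) : -1 ≤ p.crossRatio ∧ p.crossRatio ≤ 1 :=
  abs_le.1 <| (abs_crossRatio_le hp).trans (abs_le.2 (sigmaMinus_mem hp))

end StateSpace

/-! ### Evolution equations of the derived quantities -/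

namespace IsSolution

variable {v : ℝ} {x : ℝ → State}

theorem constraint (hx : IsSolution v x) (t : ℝ) :
    (x t).sigmaPlus ^ 2 + (x t).sigmaMinus ^ 2 + (x t).nMinus ^ 2 = 1 :=
  LambdaR.constraint (hx.mem t)

theorem one_sub_sigmaSq (hx : IsSolution v x) (t : ℝ) :
    1 - (x t).sigmaSq = (x t).nMinus ^ 2 := by
  have := hx.constraint t
  simp only [State.sigmaSq]
  linarith

theorem hasDerivAt_sigmaPlus (hx : IsSolution v x) (t : ℝ) :
    HasDerivAt (fun t => (x t).sigmaPlus)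
      (2 * (x t).nMinus ^ 2 * (1 + 2 * v * (x t).sigmaPlus)) t := by
  refine (hasDerivAt_pi.1 (hx.hasDerivAt t) 0).congr_deriv ?_
  simp [field, hx.one_sub_sigmaSq]

theorem hasDerivAt_sigmaMinus (hx : IsSolution v x) (t : ℝ) :
    HasDerivAt (fun t => (x t).sigmaMinus)
      (4 * v * (x t).nMinus ^ 2 * (x t).sigmaMinus + 2 * √3 * ((x t).nMinus * (x t).nPlus)) t := by
  refine (hasDerivAt_pi.1 (hx.hasDerivAt t) 1).congr_deriv ?_
  simp [field, hx.one_sub_sigmaSq, State.nMinus, State.nPlus]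
  ring

theorem hasDerivAt_n2 (hx : IsSolution v x) (t : ℝ) :
    HasDerivAt (fun t => (x t).n2)
      (-2 * (2 * v * (1 - (x t).nMinus ^ 2) + (x t).sigmaPlus + √3 * (x t).sigmaMinus)
        * (x t).n2) t := by
  refine (hasDerivAt_pi.1 (hx.hasDerivAt t) 2).congr_deriv ?_
  simp [field, ← hx.one_sub_sigmaSq]

theorem hasDerivAt_n3 (hx : IsSolution v x) (t : ℝ) :
    HasDerivAt (fun t => (x t).n3)
      (-2 * (2 * v * (1 - (x t).nMinus ^ 2) + (x t).sigmaPlus - √3 * (x t).sigmaMinus)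
        * (x t).n3) t := by
  refine (hasDerivAt_pi.1 (hx.hasDerivAt t) 3).congr_deriv ?_
  simp [field, ← hx.one_sub_sigmaSq]

theorem hasDerivAt_nMinus (hx : IsSolution v x) (t : ℝ) :
    HasDerivAt (fun t => (x t).nMinus)
      (-2 * (2 * v * (1 - (x t).nMinus ^ 2) + (x t).sigmaPlus) * (x t).nMinus
        - 2 * √3 * ((x t).sigmaMinus * (x t).nPlus)) t := by
  refine ((hx.hasDerivAt_n2 t).sub (hx.hasDerivAt_n3 t)).congr_deriv ?_
  simp only [State.nMinus, State.nPlus]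
  ring

theorem hasDerivAt_nPlus (hx : IsSolution v x) (t : ℝ) :
    HasDerivAt (fun t => (x t).nPlus)
      (-2 * (2 * v * (1 - (x t).nMinus ^ 2) + (x t).sigmaPlus) * (x t).nPlus
        - 2 * √3 * ((x t).sigmaMinus * (x t).nMinus)) t := by
  refine ((hx.hasDerivAt_n2 t).add (hx.hasDerivAt_n3 t)).congr_deriv ?_
  simp only [State.nMinus, State.nPlus]
  ring

/-- The common growth rates of `N₋` and `N₊` cancel in the quotient, and the rotation terms lose
their factor `N₊`. The right-hand side is therefore bounded even where `N₊` is not. -/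
theorem hasDerivAt_crossRatio (hx : IsSolution v x) (t : ℝ) :
    HasDerivAt (fun t => (x t).crossRatio)
      (2 * √3 * ((x t).nMinus ^ 2 - (x t).sigmaMinus ^ 2)
        + 4 * v * (x t).nMinus ^ 2 * (x t).crossRatio + 2 * √3 * (x t).crossRatio ^ 2) t := by
  have hP := (nPlus_pos (hx.mem t)).ne'
  refine (((hx.hasDerivAt_sigmaMinus t).mul (hx.hasDerivAt_nMinus t)).div
    (hx.hasDerivAt_nPlus t) hP).congr_deriv ?_
  simp only [State.crossRatio, Pi.mul_apply]
  field_simp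
  ring

theorem hasDerivAt_log_n2 (hx : IsSolution v x) (t : ℝ) :
    HasDerivAt (fun t => log (x t).n2)
      (-2 * (2 * v * (1 - (x t).nMinus ^ 2) + (x t).sigmaPlus + √3 * (x t).sigmaMinus)) t := by
  have h := (hx.mem t).1.ne'
  refine ((hx.hasDerivAt_n2 t).log h).congr_deriv ?_
  field_simp

theorem hasDerivAt_log_n3 (hx : IsSolution v x) (t : ℝ) :
    HasDerivAt (fun t => log (x t).n3)
      (-2 * (2 * v * (1 - (x t).nMinus ^ 2) + (x t).sigmaPlus - √3 * (x t).sigmaMinus)) t := by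
  have h := (hx.mem t).2.1.ne'
  refine ((hx.hasDerivAt_n3 t).log h).congr_deriv ?_
  field_simp

theorem hasDerivAt_log_nProd (hx : IsSolution v x) (t : ℝ) :
    HasDerivAt (fun t => log (x t).nProd)
      (-4 * (2 * v * (1 - (x t).nMinus ^ 2) + (x t).sigmaPlus)) t := by
  have h : (fun t => log (x t).nProd) = fun t => log (x t).n2 + log (x t).n3 := by
    funext s
    exact log_mul (hx.mem s).1.ne' (hx.mem s).2.1.ne'
  rw [h]
  exact ((hx.hasDerivAt_log_n2 t).add (hx.hasDerivAt_log_n3 t)).congr_deriv (by ring)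

/-- The square covers both signs of `1 + 2vΣ₊`, which both occur when `v > 1/2`. -/
theorem hasDerivAt_log_sq (hx : IsSolution v x) (t : ℝ)
    (h : 1 + 2 * v * (x t).sigmaPlus ≠ 0) :
    HasDerivAt (fun t => log ((1 + 2 * v * (x t).sigmaPlus) ^ 2)) (8 * v * (x t).nMinus ^ 2) t := by
  refine (((((hx.hasDerivAt_sigmaPlus t).const_mul (2 * v)).const_add 1).pow 2).log
    (pow_ne_zero 2 h)).congr_deriv ?_
  simp only [Pi.pow_apply]
  field_simp
  ring

theorem continuous_sigmaPlus (hx : IsSolution v x) : Continuous fun t => (x t).sigmaPlus :=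
  continuous_iff_continuousAt.2 fun t => (hx.hasDerivAt_sigmaPlus t).continuousAt

theorem continuous_sigmaMinus (hx : IsSolution v x) : Continuous fun t => (x t).sigmaMinus :=
  continuous_iff_continuousAt.2 fun t => (hx.hasDerivAt_sigmaMinus t).continuousAt

theorem continuous_nMinus (hx : IsSolution v x) : Continuous fun t => (x t).nMinus :=
  continuous_iff_continuousAt.2 fun t => (hx.hasDerivAt_nMinus t).continuousAt

theorem continuous_nPlus (hx : IsSolution v x) : Continuous fun t => (x t).nPlus :=
  continuous_iff_continuousAt.2 fun t => (hx.hasDerivAt_nPlus t).continuousAt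

end IsSolution

end LambdaR

/-! ### The invariant LRS sets -/

namespace LambdaR

theorem mem_lrsPlus_of {p : State} (hp : p ∈ typeVII0) (h : p.sigmaPlus = 1) : p ∈ lrsPlus := by
  have hc := constraint hp
  rw [h] at hc
  have hY : p.sigmaMinus = 0 := by nlinarith [sq_nonneg p.sigmaMinus, sq_nonneg p.nMinus]
  have hM : p.nMinus = 0 := by nlinarith [sq_nonneg p.sigmaMinus, sq_nonneg p.nMinus]
  exact ⟨h, hY, sub_eq_zero.1 hM, hp.1⟩

theorem mem_lrsMinus_of {p : State} (hp : p ∈ typeVII0) (h : p.sigmaPlus = -1) :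
    p ∈ lrsMinus := by
  have hc := constraint hp
  rw [h] at hc
  have hY : p.sigmaMinus = 0 := by nlinarith [sq_nonneg p.sigmaMinus, sq_nonneg p.nMinus]
  have hM : p.nMinus = 0 := by nlinarith [sq_nonneg p.sigmaMinus, sq_nonneg p.nMinus]
  exact ⟨h, hY, sub_eq_zero.1 hM, hp.1⟩

namespace IsSolution

variable {v : ℝ} {x : ℝ → State}

/-- The set `Σ₊² = 1` is invariant, and `Σ₊` is constant on it. -/
theorem sigmaPlus_eq_of_sq_eq_one (hv0 : 0 < v) (hv1 : v < 1) (hx : IsSolution v x) {t₀ : ℝ}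
    (h : (x t₀).sigmaPlus ^ 2 = 1) (t : ℝ) : (x t).sigmaPlus = (x t₀).sigmaPlus := by
  have hW : ∀ t, 1 - (x t).sigmaPlus ^ 2 = 0 := by
    -- The derivative of `1 - Σ₊²` has absolute value `4 N₋² |Σ₊| |1 + 2vΣ₊|`, where the last factor
    -- is at most `3` and `N₋² ≤ 1 - Σ₊²`.
    refine eq_zero_of_abs_deriv_le (K := 12) (t₀ := t₀)
      (fun t => ((hx.hasDerivAt_sigmaPlus t).pow 2).const_sub 1) (fun t => ?_) (fun t => ?_)
      (by linarith)
    · nlinarith [hx.constraint t, sq_nonneg (x t).sigmaMinus, sq_nonneg (x t).nMinus]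
    · obtain ⟨h1, h2⟩ := sigmaPlus_mem (hx.mem t)
      have hM : (x t).nMinus ^ 2 ≤ 1 - (x t).sigmaPlus ^ 2 := by
        nlinarith [hx.constraint t, sq_nonneg (x t).sigmaMinus]
      have hZ : |1 + 2 * v * (x t).sigmaPlus| ≤ 3 := by rw [abs_le]; constructor <;> nlinarith
      have hX : |(x t).sigmaPlus| ≤ 1 := abs_le.2 ⟨h1, h2⟩
      have hXZ : |(x t).sigmaPlus| * |1 + 2 * v * (x t).sigmaPlus| ≤ 1 * 3 :=
        mul_le_mul hX hZ (abs_nonneg _) zero_le_one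
      have he : -(((2 : ℕ) : ℝ) * (x t).sigmaPlus ^ (2 - 1) *
          (2 * (x t).nMinus ^ 2 * (1 + 2 * v * (x t).sigmaPlus)))
          = -(4 * (x t).nMinus ^ 2 * ((x t).sigmaPlus * (1 + 2 * v * (x t).sigmaPlus))) := by
        push_cast; ring
      rw [he, abs_neg, abs_mul, abs_mul (x t).sigmaPlus, abs_of_nonneg (by positivity)]
      nlinarith [sq_nonneg (x t).nMinus]
  refine is_const_of_deriv_eq_zero
    (fun s => (hx.hasDerivAt_sigmaPlus s).differentiableAt) (fun s => ?_) t t₀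
  have hM : (x s).nMinus ^ 2 = 0 := by
    nlinarith [hx.constraint s, hW s, sq_nonneg (x s).nMinus, sq_nonneg (x s).sigmaMinus]
  rw [(hx.hasDerivAt_sigmaPlus s).deriv, hM]
  ring

theorem lrs_or_sq_lt_one (hv0 : 0 < v) (hv1 : v < 1) (hx : IsSolution v x) :
    range x ⊆ lrsPlus ∨ (∀ t, (x t).sigmaPlus = -1) ∨ ∀ t, (x t).sigmaPlus ^ 2 < 1 := by
  by_cases h : ∃ t₀, (x t₀).sigmaPlus ^ 2 = 1
  · obtain ⟨t₀, h⟩ := h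
    rcases sq_eq_one_iff.1 h with h1 | h1
    · left
      rintro _ ⟨t, rfl⟩
      exact mem_lrsPlus_of (hx.mem t) ((hx.sigmaPlus_eq_of_sq_eq_one hv0 hv1 h t).trans h1)
    · exact Or.inr <| Or.inl fun t => (hx.sigmaPlus_eq_of_sq_eq_one hv0 hv1 h t).trans h1
  · push Not at h
    refine Or.inr <| Or.inr fun t => lt_of_le_of_ne ?_ (h t)
    nlinarith [hx.constraint t, sq_nonneg (x t).sigmaMinus, sq_nonneg (x t).nMinus]

theorem sq_lt_one_of_not_lrs (hv0 : 0 < v) (hv1 : v < 1) (hx : IsSolution v x)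
    (h : ¬ range x ⊆ lrsPlus ∪ lrsMinus) (t : ℝ) : (x t).sigmaPlus ^ 2 < 1 := by
  rcases hx.lrs_or_sq_lt_one hv0 hv1 with h1 | h1 | h1
  · exact absurd (h1.trans subset_union_left) h
  · refine absurd ?_ h
    rintro _ ⟨t, rfl⟩
    exact Or.inr (mem_lrsMinus_of (hx.mem t) (h1 t))
  · exact h1 t

end IsSolution

/-- The set `Σ₊ = σ`, `Σ₋ = 0`, `N₂ = N₃ > 0`, for `σ = ±1`, is one orbit with `N → ∞` towards
the past, if `2 v + σ > 0`. -/
theorem isOrbitWithPastUnboundedN_lrs {v σ : ℝ} (hv0 : 0 < v) (hv1 : v < 1) (hσ : σ ^ 2 = 1)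
    (hk : 0 < 2 * v + σ) :
    IsOrbitWithPastUnboundedN v
      {p | p.sigmaPlus = σ ∧ p.sigmaMinus = 0 ∧ p.n2 = p.n3 ∧ 0 < p.n2} := by
  set S : Set State := {p | p.sigmaPlus = σ ∧ p.sigmaMinus = 0 ∧ p.n2 = p.n3 ∧ 0 < p.n2}
  have key : ∀ x, IsSolution v x → x 0 ∈ S →
      range x = S ∧ Tendsto (fun t => (x t).n2) atBot atTop := by
    intro x hx h0
    have hX : ∀ t, (x t).sigmaPlus = σ := fun t =>
      (hx.sigmaPlus_eq_of_sq_eq_one hv0 hv1 (t₀ := 0) (by rw [h0.1, hσ]) t).trans h0.1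
    have hY : ∀ t, (x t).sigmaMinus = 0 := fun t => by
      nlinarith [hx.constraint t, hX t, sq_nonneg (x t).sigmaMinus, sq_nonneg (x t).nMinus]
    have hM : ∀ t, (x t).nMinus = 0 := fun t => by
      nlinarith [hx.constraint t, hX t, sq_nonneg (x t).sigmaMinus, sq_nonneg (x t).nMinus]
    have hmem : ∀ t, x t ∈ S := fun t => ⟨hX t, hY t, sub_eq_zero.1 (hM t), (hx.mem t).1⟩
    have hlog : ∀ t, log (x t).n2 = log (x 0).n2 - 2 * (2 * v + σ) * t := fun t => by
      have hd : ∀ s, HasDerivAt (fun s => log (x s).n2 + 2 * (2 * v + σ) * s) 0 s := fun s => by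
        refine ((hx.hasDerivAt_log_n2 s).add
          ((hasDerivAt_id s).const_mul (2 * (2 * v + σ)))).congr_deriv ?_
        rw [hX, hY, hM]
        ring
      have := is_const_of_deriv_eq_zero (fun s => (hd s).differentiableAt)
        (fun s => (hd s).deriv) t 0
      linarith
    have hN : ∀ t, (x t).n2 = exp (log (x 0).n2 - 2 * (2 * v + σ) * t) := fun t => by
      rw [← hlog, exp_log (hx.mem t).1]
    refine ⟨Subset.antisymm (range_subset_iff.2 hmem) fun p hp => ?_, ?_⟩
    · refine ⟨(log (x 0).n2 - log p.n2) / (2 * (2 * v + σ)), ?_⟩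
      set t := (log (x 0).n2 - log p.n2) / (2 * (2 * v + σ)) with ht
      have h2 : (x t).n2 = p.n2 := by
        rw [hN, ht, mul_div_cancel₀ _ (by positivity), sub_sub_cancel, exp_log hp.2.2.2]
      funext i
      fin_cases i
      · exact (hX t).trans hp.1.symm
      · exact (hY t).trans hp.2.1.symm
      · exact h2
      · exact (hmem t).2.2.1.symm.trans (h2.trans hp.2.2.1)
    · refine Tendsto.congr (fun t => (hN t).symm) ?_
      refine tendsto_exp_atTop.comp ((tendsto_linear_atBot (show 0 < 2 * (2 * v + σ) by positivity)
        (log (x 0).n2) 0).congr fun t => ?_)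
      ring
  refine ⟨⟨fun t => ![σ, 0, exp (-(2 * (2 * v + σ)) * t), exp (-(2 * (2 * v + σ)) * t)], ?_⟩, key⟩
  suffices h : IsSolution v
      (fun t => ![σ, 0, exp (-(2 * (2 * v + σ)) * t), exp (-(2 * (2 * v + σ)) * t)]) from
    ⟨h, (key _ h ⟨rfl, rfl, rfl, exp_pos _⟩).1⟩
  have hexp : ∀ t, HasDerivAt (fun t => exp (-(2 * (2 * v + σ)) * t))
      (-2 * (2 * v + σ) * exp (-(2 * (2 * v + σ)) * t)) t := fun t =>
    (((hasDerivAt_id t).const_mul _).exp).congr_deriv (by simp only [id]; ring)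
  refine ⟨fun t => ⟨exp_pos _, exp_pos _, ?_⟩, fun t => hasDerivAt_pi.2 fun i => ?_⟩
  · simp [State.sigmaSq, State.sigmaPlus, State.sigmaMinus, State.n2, State.n3, hσ]
  · fin_cases i
    · simpa [field, State.sigmaSq, State.sigmaPlus, State.sigmaMinus, hσ]
        using hasDerivAt_const t σ
    · simpa [field, State.sigmaSq, State.sigmaPlus, State.sigmaMinus, State.n2, State.n3]
        using hasDerivAt_const t (0 : ℝ)
    · simpa [field, State.sigmaSq, State.sigmaPlus, State.sigmaMinus, State.n2, hσ] using hexp t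
    · simpa [field, State.sigmaSq, State.sigmaPlus, State.sigmaMinus, State.n3, hσ] using hexp t

/-! ### Averaging, and lower bounds on N₂N₃ for v ≥ 1/2 -/

namespace IsSolution

variable {v : ℝ} {x : ℝ → State}

/-- Averaging: as `N₊` stays away from zero, `N₋²` has a positive time average, unless `Σ₊` comes
close to `±1` or to `-1/(2v)`. -/
theorem false_of_averaging (hv0 : 0 < v) (hv1 : v < 1) (hx : IsSolution v x) {T a b c z : ℝ}
    (ha : -1 < a) (hb : b < 1) (hc : 0 < c) (hz : 0 < z)
    (hX : ∀ t ≤ T, a ≤ (x t).sigmaPlus ∧ (x t).sigmaPlus ≤ b)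
    (hP : ∀ t ≤ T, c ≤ (x t).nPlus)
    (hZ : ∀ t ≤ T, z ≤ (1 + 2 * v * (x t).sigmaPlus) ^ 2) : False := by
  have hs : 0 < √3 := by positivity
  -- `K` collects every coefficient of `N₋²` in the derivative of `u`, after inserting `Σ₋² = 1 -
  -- Σ₊² - N₋²`, `u ≤ 1` and `u² ≤ N₋²/c²`. Subtracting `K/(8v) log ((1 + 2vΣ₊)²)` cancels them all
  -- and leaves at most `-2√3(1 - Σ₊²)`.
  set K := 4 * √3 + 4 * v + 2 * √3 / c ^ 2 with hK
  have hK0 : 0 < K := by positivity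
  have hε : 0 < 2 * √3 * ((1 - b) * (1 + a)) :=
    mul_pos (by positivity) (mul_pos (by linarith) (by linarith))
  refine false_of_deriv_le (T := T) (B := 1 - K / (8 * v) * log z) hε
    (fun t ht => (hx.hasDerivAt_crossRatio t).sub ((hx.hasDerivAt_log_sq t fun h0 => by
      have := hZ t ht
      rw [h0] at this
      norm_num at this
      linarith).const_mul (K / (8 * v)))) (fun t ht => ?_) (fun t ht => ?_)
  · have hW : (1 - b) * (1 + a) ≤ 1 - (x t).sigmaPlus ^ 2 := by
      nlinarith [hX t ht]
    have hcon := hx.constraint t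
    have hu := crossRatio_mem (hx.mem t)
    have hu2 : (x t).crossRatio ^ 2 ≤ (x t).nMinus ^ 2 / c ^ 2 := by
      rw [le_div_iff₀ (by positivity)]
      have h1 := crossRatio_mul_nPlus (hx.mem t)
      have h2 : (x t).crossRatio ^ 2 * c ^ 2 ≤ (x t).crossRatio ^ 2 * (x t).nPlus ^ 2 :=
        mul_le_mul_of_nonneg_left (pow_le_pow_left₀ hc.le (hP t ht) 2) (sq_nonneg _)
      have h3 : (x t).crossRatio ^ 2 * (x t).nPlus ^ 2
          = (x t).sigmaMinus ^ 2 * (x t).nMinus ^ 2 := by rw [← mul_pow, h1, mul_pow]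
      nlinarith [sq_nonneg (x t).nMinus, sq_nonneg (x t).sigmaPlus]
    have e1 : K / (8 * v) * (8 * v * (x t).nMinus ^ 2) = K * (x t).nMinus ^ 2 := by
      field_simp
    have e2 : K * (x t).nMinus ^ 2 = 4 * √3 * (x t).nMinus ^ 2 + 4 * v * (x t).nMinus ^ 2
        + 2 * √3 * ((x t).nMinus ^ 2 / c ^ 2) := by rw [hK]; ring
    have h4 : 4 * v * (x t).nMinus ^ 2 * (x t).crossRatio ≤ 4 * v * (x t).nMinus ^ 2 :=
      mul_le_of_le_one_right (by positivity) hu.2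
    have h5 := mul_le_mul_of_nonneg_left hu2 (show 0 ≤ 2 * √3 by positivity)
    have h6 := mul_le_mul_of_nonneg_left hW (show 0 ≤ 2 * √3 by positivity)
    have h7 : (x t).sigmaMinus ^ 2 = 1 - (x t).sigmaPlus ^ 2 - (x t).nMinus ^ 2 := by linarith
    rw [e1, e2, h7]
    linarith
  · have h1 := (crossRatio_mem (hx.mem t)).2
    have h2 := mul_le_mul_of_nonneg_left (log_le_log hz (hZ t ht))
      (show 0 ≤ K / (8 * v) by positivity)
    simp only [Pi.sub_apply]
    linarith

/-- The derivative of `log (N₂ N₃) - (2v/√3) Σ₋N₋/N₊`. -/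
theorem hasDerivAt_log_nProd_sub_crossRatio (hx : IsSolution v x) (t : ℝ) :
    HasDerivAt (fun t => log (x t).nProd - 2 * v * √3 / 3 * (x t).crossRatio)
      (-4 * (v + (x t).sigmaPlus + v * (x t).sigmaPlus ^ 2) - 4 * v * (x t).crossRatio ^ 2
        - 8 * √3 * v ^ 2 / 3 * (x t).nMinus ^ 2 * (x t).crossRatio) t := by
  refine ((hx.hasDerivAt_log_nProd t).sub
    ((hx.hasDerivAt_crossRatio t).const_mul (2 * v * √3 / 3))).congr_deriv ?_
  have h3 : √3 ^ 2 = 3 := sq_sqrt (by norm_num)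
  have h7 : (x t).sigmaMinus ^ 2 = 1 - (x t).sigmaPlus ^ 2 - (x t).nMinus ^ 2 := by
    linarith [hx.constraint t]
  rw [h7]
  linear_combination (-(4 * v / 3) * (2 * (x t).nMinus ^ 2 - 1 + (x t).sigmaPlus ^ 2
    + (x t).crossRatio ^ 2)) * h3

/-- Completing the square in `u` leaves the error `(4v³/3) N₋⁴ ≤ (4v³/3)(1 - Σ₊²)²`. At `v = 1/2` it
is absorbed by `-2(1 + Σ₊)²`; for larger `v` the surplus is `-4(v - 1/2)` against `7/3 (v - 1/2)`.
-/
theorem deriv_log_nProd_sub_crossRatio_le (hv : 1 / 2 ≤ v) (hv1 : v < 1) (hx : IsSolution v x)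
    (t : ℝ) :
    -4 * (v + (x t).sigmaPlus + v * (x t).sigmaPlus ^ 2) - 4 * v * (x t).crossRatio ^ 2
        - 8 * √3 * v ^ 2 / 3 * (x t).nMinus ^ 2 * (x t).crossRatio ≤ -(5 / 3 * (v - 1 / 2)) := by
  have h3 : √3 ^ 2 = 3 := sq_sqrt (by norm_num)
  obtain ⟨hX1, hX2⟩ := sigmaPlus_mem (hx.mem t)
  have hM : (x t).nMinus ^ 2 ≤ 1 - (x t).sigmaPlus ^ 2 := by
    nlinarith [hx.constraint t, sq_nonneg (x t).sigmaMinus]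
  set X := (x t).sigmaPlus
  set m := (x t).nMinus ^ 2 with hm
  set u := (x t).crossRatio
  have hm0 : 0 ≤ m := sq_nonneg _
  have hsq : -4 * v * u ^ 2 - 8 * √3 * v ^ 2 / 3 * m * u ≤ 4 * v ^ 3 / 3 * m ^ 2 := by
    have : 0 ≤ 4 * v * (u + √3 * v / 3 * m) ^ 2 := by positivity
    have e : 4 * v * (u + √3 * v / 3 * m) ^ 2
        = 4 * v * u ^ 2 + 8 * √3 * v ^ 2 / 3 * m * u + 4 * v ^ 3 / 3 * m ^ 2 := by
      linear_combination (4 * v ^ 3 * m ^ 2 / 9) * h3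
    linarith
  have hm2 : m ^ 2 ≤ (1 - X ^ 2) ^ 2 := pow_le_pow_left₀ hm0 hM 2
  have hm3 : 4 * v ^ 3 / 3 * m ^ 2 ≤ 4 * v ^ 3 / 3 * (1 - X ^ 2) ^ 2 :=
    mul_le_mul_of_nonneg_left hm2 (by positivity)
  have hw : (1 - X ^ 2) ^ 2 ≤ 1 := by
    have : 0 ≤ 1 - X ^ 2 := hm0.trans hM
    nlinarith [sq_nonneg X]
  -- `7/4` is the slope of the chord of `v³` over `[1/2, 1]`; convexity puts `v³` below the chord.
  have hq : 0 ≤ (v - 1 / 2) * (7 / 4 - (v ^ 2 + v / 2 + 1 / 4)) :=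
    mul_nonneg (by linarith) (by nlinarith)
  have hv3 : v ^ 3 ≤ 1 / 8 + 7 / 4 * (v - 1 / 2) := by nlinarith
  have hv4 : v ^ 3 * (1 - X ^ 2) ^ 2 ≤ 1 / 8 * (1 - X ^ 2) ^ 2 + 7 / 4 * (v - 1 / 2) := by
    nlinarith [mul_le_mul_of_nonneg_right hv3 (sq_nonneg (1 - X ^ 2)),
      mul_nonneg (sub_nonneg.2 hv) (sub_nonneg.2 hw)]
  have hbase : 0 ≤ 3 / 2 * (1 + X) ^ 2 - 1 / 8 * (1 - X ^ 2) ^ 2 := by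
    have : 0 ≤ (1 + X) ^ 2 * (3 / 2 - 1 / 8 * (1 - X) ^ 2) :=
      mul_nonneg (sq_nonneg _) (by nlinarith)
    nlinarith
  have hX3 : 0 ≤ (v - 1 / 2) * X ^ 2 := mul_nonneg (by linarith) (sq_nonneg X)
  nlinarith

/-- For `v ≥ 1/2` the product `N₂ N₃` stays away from zero towards the past. -/
theorem exists_le_nProd (hv : 1 / 2 ≤ v) (hv1 : v < 1) (hx : IsSolution v x) :
    ∃ c > 0, ∀ t ≤ 0, c ≤ (x t).nProd := by
  refine ⟨exp (log (x 0).nProd - 2 * v * √3 / 3 * (x 0).crossRatio - 2 * v * √3 / 3),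
    exp_pos _, fun t ht => ?_⟩
  rw [← le_log_iff_exp_le (nProd_pos (hx.mem t))]
  have := le_of_deriv_nonpos (T := 0) (fun t _ => hx.hasDerivAt_log_nProd_sub_crossRatio t)
    (fun t _ => (hx.deriv_log_nProd_sub_crossRatio_le hv hv1 t).trans (by linarith)) ht
  have hu := (crossRatio_mem (hx.mem t)).1
  have : 0 < 2 * v * √3 / 3 := by positivity
  nlinarith

theorem tendsto_nProd_atTop (hv : 1 / 2 < v) (hv1 : v < 1) (hx : IsSolution v x) :
    Tendsto (fun t => (x t).nProd) atBot atTop := by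
  have h := tendsto_atTop_of_deriv_le (T := 0) (show 0 < 5 / 3 * (v - 1 / 2) by linarith)
    (fun t _ => hx.hasDerivAt_log_nProd_sub_crossRatio t)
    (fun t _ => hx.deriv_log_nProd_sub_crossRatio_le hv.le hv1 t)
  have h2 : Tendsto (fun t => log (x t).nProd) atBot atTop := by
    refine tendsto_atTop_mono (fun t => ?_)
      (tendsto_atTop_add_const_right _ (-(2 * v * √3 / 3)) h)
    have hu := (crossRatio_mem (hx.mem t)).1
    have : 0 < 2 * v * √3 / 3 := by positivity
    nlinarith
  exact (tendsto_exp_atTop.comp h2).congr fun t => exp_log (nProd_pos (hx.mem t))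

theorem nPlus_ge_of_nProd_ge (hx : IsSolution v x) {c t : ℝ}
    (h : c ≤ (x t).nProd) : √c ≤ (x t).nPlus := by
  refine (sqrt_le_left (nPlus_pos (hx.mem t)).le).2 ?_
  nlinarith [nPlus_sq (x t), sq_nonneg (x t).nMinus]

end IsSolution

end LambdaR

/-! ### The case v < 1/2 -/

namespace LambdaR

theorem alphaLimit_eq_singleton {x : ℝ → State} {p : State} (h : Tendsto x atBot (𝓝 p)) :
    alphaLimit x = {p} := by
  refine Subset.antisymm (fun q ⟨t, ht, hq⟩ => tendsto_nhds_unique hq (h.comp ht)) ?_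
  rintro _ rfl
  have ht : Tendsto (fun n : ℕ => -(n : ℝ)) atTop atBot :=
    tendsto_neg_atTop_atBot.comp tendsto_natCast_atTop_atTop
  exact ⟨_, ht, h.comp ht⟩

namespace IsSolution

variable {v : ℝ} {x : ℝ → State}

theorem exists_tendsto_sigmaPlus (hv0 : 0 < v) (hv : v ≤ 1 / 2) (hx : IsSolution v x) :
    ∃ σ, Tendsto (fun t => (x t).sigmaPlus) atBot (𝓝 σ) ∧
      Monotone (fun t => (x t).sigmaPlus) ∧ ∀ t, σ ≤ (x t).sigmaPlus := by
  have hmono : Monotone fun t => (x t).sigmaPlus := fun s t hst =>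
    le_of_deriv_nonneg (fun r _ => hx.hasDerivAt_sigmaPlus r) (fun r _ => by
      obtain ⟨h1, h2⟩ := sigmaPlus_mem (hx.mem r)
      have : 0 ≤ 1 + 2 * v * (x r).sigmaPlus := by nlinarith
      positivity) hst
  have hbdd : BddBelow (range fun t => (x t).sigmaPlus) :=
    ⟨-1, by rintro _ ⟨t, rfl⟩; exact (sigmaPlus_mem (hx.mem t)).1⟩
  exact ⟨_, tendsto_atBot_ciInf hmono hbdd, hmono, fun t => ciInf_le hbdd t⟩

theorem one_add_pos (hv0 : 0 < v) (hv : v < 1 / 2) (hx : IsSolution v x) (t : ℝ) :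
    1 - 2 * v ≤ 1 + 2 * v * (x t).sigmaPlus ∧ 1 + 2 * v * (x t).sigmaPlus ≤ 2 := by
  obtain ⟨h1, h2⟩ := sigmaPlus_mem (hx.mem t)
  constructor <;> nlinarith

/-- The terms `8v N₋²` of the two logarithms cancel, so the sign of `2v + Σ₊` alone decides whether
`N₂N₃` grows or decays, up to a bounded factor. -/
theorem hasDerivAt_log_nProd_sub_log_sq (hv0 : 0 < v) (hv : v < 1 / 2) (hx : IsSolution v x)
    (t : ℝ) :
    HasDerivAt (fun t => log (x t).nProd - log ((1 + 2 * v * (x t).sigmaPlus) ^ 2))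
      (-4 * (2 * v + (x t).sigmaPlus)) t := by
  have h := hx.one_add_pos hv0 hv t
  exact ((hx.hasDerivAt_log_nProd t).sub (hx.hasDerivAt_log_sq t (by linarith))).congr_deriv
    (by ring)

/-- Otherwise `N₂N₃` would be bounded below in the past while the monotone `Σ₊` stays in `[-2v,
Σ₊(0)] ⊂ (-1, 1)`, contrary to averaging. -/
theorem exists_sigmaPlus_lt (hv0 : 0 < v) (hv : v < 1 / 2) (hx : IsSolution v x)
    (hlrs : ¬ range x ⊆ lrsPlus) : ∃ T, (x T).sigmaPlus < -2 * v := by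
  by_contra! hcon
  have hlt : ∀ t, (x t).sigmaPlus ^ 2 < 1 := by
    rcases hx.lrs_or_sq_lt_one hv0 (by linarith) with h | h | h
    · exact absurd h hlrs
    · linarith [h 0, hcon 0]
    · exact h
  obtain ⟨σ, -, hmono, -⟩ := hx.exists_tendsto_sigmaPlus hv0 hv.le
  have hsq : ∀ t, (1 - 2 * v) ^ 2 ≤ (1 + 2 * v * (x t).sigmaPlus) ^ 2 := fun t =>
    pow_le_pow_left₀ (by linarith) (hx.one_add_pos hv0 hv t).1 2
  have hz : 0 < (1 - 2 * v) ^ 2 := pow_pos (by linarith) 2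
  set ℓ := log (x 0).nProd - log ((1 + 2 * v * (x 0).sigmaPlus) ^ 2) + log ((1 - 2 * v) ^ 2)
    with hℓ
  have hQ : ∀ t ≤ 0, exp ℓ ≤ (x t).nProd := fun t ht => by
    rw [← le_log_iff_exp_le (nProd_pos (hx.mem t))]
    have := le_of_deriv_nonpos (T := 0) (fun t _ => hx.hasDerivAt_log_nProd_sub_log_sq hv0 hv t)
      (fun t _ => by linarith [hcon t]) ht
    linarith [log_le_log hz (hsq t)]
  exact hx.false_of_averaging hv0 (by linarith) (a := -2 * v) (b := (x 0).sigmaPlus) (T := 0)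
    (by linarith) (abs_lt.1 ((sq_lt_one_iff_abs_lt_one _).1 (hlt 0))).2
    (sqrt_pos.2 (exp_pos ℓ)) hz (fun t ht => ⟨hcon t, hmono ht⟩)
    (fun t ht => hx.nPlus_ge_of_nProd_ge (hQ t ht)) (fun t _ => hsq t)

theorem tendsto_nProd_zero (hv0 : 0 < v) (hv : v < 1 / 2) (hx : IsSolution v x)
    (hlrs : ¬ range x ⊆ lrsPlus) : Tendsto (fun t => (x t).nProd) atBot (𝓝 0) := by
  obtain ⟨T, hT⟩ := hx.exists_sigmaPlus_lt hv0 hv hlrs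
  obtain ⟨σ, -, hmono, -⟩ := hx.exists_tendsto_sigmaPlus hv0 hv.le
  have h := tendsto_atTop_of_deriv_le (T := T) (show 0 < -4 * (2 * v + (x T).sigmaPlus) by linarith)
    (fun t _ => (hx.hasDerivAt_log_nProd_sub_log_sq hv0 hv t).neg)
    (fun t ht => by linarith [show (x t).sigmaPlus ≤ (x T).sigmaPlus from hmono ht])
  have h2 : Tendsto (fun t => log (x t).nProd) atBot atBot := by
    refine tendsto_atBot_mono (fun t => ?_) (tendsto_atBot_add_const_right _ (log (2 ^ 2))
      (tendsto_neg_atTop_atBot.comp h))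
    have h1 := hx.one_add_pos hv0 hv t
    have := log_le_log (pow_pos (by linarith) 2) (pow_le_pow_left₀ (by linarith) h1.2 2)
    simp only [Function.comp, Pi.neg_apply]
    linarith
  exact (tendsto_exp_atBot.comp h2).congr fun t => exp_log (nProd_pos (hx.mem t))

/-- Barbălat's lemma for the convergent function `log ((1 + 2vΣ₊)²)`; its second derivative is
bounded because `N₂N₃ → 0` keeps `N₊` bounded. -/
theorem tendsto_nMinus_sq_zero (hv0 : 0 < v) (hv : v < 1 / 2) (hx : IsSolution v x)
    (hlrs : ¬ range x ⊆ lrsPlus) : Tendsto (fun t => (x t).nMinus ^ 2) atBot (𝓝 0) := by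
  obtain ⟨σ, hσ, -, -⟩ := hx.exists_tendsto_sigmaPlus hv0 hv.le
  have hσ1 : -1 ≤ σ := ge_of_tendsto' hσ fun t => (sigmaPlus_mem (hx.mem t)).1
  obtain ⟨T, hT⟩ := eventually_atBot.1
    ((hx.tendsto_nProd_zero hv0 hv hlrs).eventually_lt_const one_pos)
  have hlog : Tendsto (fun t => log ((1 + 2 * v * (x t).sigmaPlus) ^ 2)) atBot
      (𝓝 (log ((1 + 2 * v * σ) ^ 2))) :=
    ((((hσ.const_mul (2 * v)).const_add 1).pow 2).log (pow_ne_zero 2 (by nlinarith)))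
  have hs2 : √3 ≤ 2 := by rw [sqrt_le_left (by norm_num)]; norm_num
  -- The value of `C` is generous: the estimates below give `32v(2 + 6) < 128`.
  have := tendsto_deriv_zero_of_tendsto (T := T) (C := 16 * 18) (by norm_num)
    (fun t => hx.hasDerivAt_log_sq t (by linarith [hx.one_add_pos hv0 hv t]))
    (fun t => ((hx.hasDerivAt_nMinus t).pow 2).const_mul (8 * v))
    (fun t => by positivity) (fun t ht => ?_) hlog
  · have h8 := this.const_mul (1 / (8 * v))
    rw [mul_zero] at h8
    refine h8.congr fun t => ?_
    field_simp
  · obtain ⟨hX1, hX2⟩ := sigmaPlus_mem (hx.mem t)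
    obtain ⟨hY1, hY2⟩ := sigmaMinus_mem (hx.mem t)
    obtain ⟨hM1, hM2⟩ := nMinus_mem (hx.mem t)
    have hP0 := nPlus_pos (hx.mem t)
    have hP : (x t).nPlus ≤ 3 := by nlinarith [nPlus_sq (x t), hT t ht]
    have hMsq : (x t).nMinus ^ 2 ≤ 1 := by nlinarith
    have hA : 2 * v * (1 - (x t).nMinus ^ 2) + (x t).sigmaPlus ≤ 2 := by
      nlinarith [sq_nonneg (x t).nMinus]
    have hYM : (x t).sigmaMinus * (x t).nMinus ≤ 1 := by nlinarith
    have h1 : (2 * v * (1 - (x t).nMinus ^ 2) + (x t).sigmaPlus) * (x t).nMinus ^ 2 ≤ 2 := by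
      nlinarith [sq_nonneg (x t).nMinus]
    have h2 : √3 * ((x t).sigmaMinus * (x t).nMinus * (x t).nPlus) ≤ 6 := by
      have h3 : (x t).sigmaMinus * (x t).nMinus * (x t).nPlus ≤ 3 := by nlinarith
      nlinarith [sqrt_nonneg 3]
    have e : 8 * v * (((2 : ℕ) : ℝ) * (x t).nMinus ^ (2 - 1) *
        (-2 * (2 * v * (1 - (x t).nMinus ^ 2) + (x t).sigmaPlus) * (x t).nMinus
          - 2 * √3 * ((x t).sigmaMinus * (x t).nPlus)))
        = -(32 * v * ((2 * v * (1 - (x t).nMinus ^ 2) + (x t).sigmaPlus) * (x t).nMinus ^ 2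
          + √3 * ((x t).sigmaMinus * (x t).nMinus * (x t).nPlus))) := by
      push_cast; ring
    rw [e]
    nlinarith

/-- For `v < 1/2` a non-`LRS⁺` solution converges towards the past to a point of `A₂ ∩ A₃`. -/
theorem exists_tendsto_mem_arcs (hv0 : 0 < v) (hv : v < 1 / 2) (hx : IsSolution v x)
    (hlrs : ¬ range x ⊆ lrsPlus) : ∃ p ∈ arcA2 v ∩ arcA3 v, Tendsto x atBot (𝓝 p) := by
  obtain ⟨σ, hσ, -, -⟩ := hx.exists_tendsto_sigmaPlus hv0 hv.le
  have hM := hx.tendsto_nMinus_sq_zero hv0 hv hlrs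
  have hY2 : Tendsto (fun t => (x t).sigmaMinus ^ 2) atBot (𝓝 (1 - σ ^ 2 - 0)) :=
    (((hσ.pow 2).const_sub 1).sub hM).congr fun t => by linarith [hx.constraint t]
  obtain ⟨y, hy⟩ := exists_tendsto_of_tendsto_sq hx.continuous_sigmaMinus hY2
  have hyσ : σ ^ 2 + y ^ 2 = 1 := by linarith [tendsto_nhds_unique (hy.pow 2) hY2]
  have hP : Tendsto (fun t => (x t).nPlus) atBot (𝓝 0) := by
    have h := (hM.add ((hx.tendsto_nProd_zero hv0 hv hlrs).const_mul 4)).sqrt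
    simp only [mul_zero, add_zero, sqrt_zero] at h
    refine h.congr fun t => ?_
    rw [← nPlus_sq, sqrt_sq (nPlus_pos (hx.mem t)).le]
  have hN2 : Tendsto (fun t => (x t).n2) atBot (𝓝 0) :=
    squeeze_zero (fun t => (hx.mem t).1.le)
      (fun t => by simp only [State.nPlus]; linarith [(hx.mem t).2.1]) hP
  have hN3 : Tendsto (fun t => (x t).n3) atBot (𝓝 0) :=
    squeeze_zero (fun t => (hx.mem t).2.1.le)
      (fun t => by simp only [State.nPlus]; linarith [(hx.mem t).1]) hP
  -- If the limiting rate `ρ` were positive, `log N` would grow without bound towards the past. For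
  -- `N₂` and `N₃` the rates are `2v + σ ± √3 y`, which gives the two arc inequalities.
  have hdecay : ∀ {N r : ℝ → ℝ} {ρ : ℝ}, (∀ t, 0 < N t) → Tendsto N atBot (𝓝 0) →
      (∀ t, HasDerivAt (fun t => log (N t)) (-2 * r t) t) → Tendsto r atBot (𝓝 ρ) → ρ ≤ 0 := by
    intro N r ρ hN0 hN hd hr
    by_contra! hρ
    obtain ⟨T, hT⟩ := eventually_atBot.1
      ((hr.eventually_const_lt (half_lt_self hρ)).and (hN.eventually_lt_const one_pos))
    exact false_of_deriv_le (T := T) (B := 0) hρ (fun t _ => hd t)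
      (fun t ht => by linarith [(hT t ht).1]) (fun t ht => log_nonpos (hN0 t).le (hT t ht).2.le)
  have h2 := hdecay (fun t => (hx.mem t).1) hN2 hx.hasDerivAt_log_n2
    ((((hM.const_sub 1).const_mul (2 * v)).add hσ).add (hy.const_mul √3))
  have h3 := hdecay (fun t => (hx.mem t).2.1) hN3 hx.hasDerivAt_log_n3
    ((((hM.const_sub 1).const_mul (2 * v)).add hσ).sub (hy.const_mul √3))
  have hK : (![σ, y, 0, 0] : State) ∈ kasnerCircle := ⟨hyσ, rfl, rfl⟩
  refine ⟨![σ, y, 0, 0], ⟨⟨hK, ?_⟩, hK, ?_⟩, tendsto_pi_nhds.2 fun i => ?_⟩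
  · change σ + √3 * y ≤ -2 * v
    linarith
  · change σ - √3 * y ≤ -2 * v
    linarith
  · fin_cases i
    exacts [hσ, hy, hN2, hN3]

end IsSolution

/-! ### The case v = 1/2 -/

/-- Every limit point towards the past of a solution that satisfies `Σ₊ → -1` and keeps
`N₂ N₃` away from zero lies in `LRS⁻`. -/
theorem alphaLimit_subset_lrsMinus {v c T : ℝ} {x : ℝ → State} (hx : IsSolution v x)
    (hX : Tendsto (fun t => (x t).sigmaPlus) atBot (𝓝 (-1))) (hc : 0 < c)
    (hQ : ∀ t ≤ T, c ≤ (x t).nProd) : alphaLimit x ⊆ lrsMinus := by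
  rintro p ⟨t, ht, hp⟩
  have hi : ∀ i, Tendsto (fun n => x (t n) i) atTop (𝓝 (p i)) := tendsto_pi_nhds.1 hp
  have h0 : p.sigmaPlus = -1 := tendsto_nhds_unique (hi 0) (hX.comp ht)
  have h2 : 0 ≤ p.n2 := ge_of_tendsto' (hi 2) fun n => (hx.mem (t n)).1.le
  have h3 : 0 ≤ p.n3 := ge_of_tendsto' (hi 3) fun n => (hx.mem (t n)).2.1.le
  have h23 : c ≤ p.n2 * p.n3 := ge_of_tendsto ((hi 2).mul (hi 3))
    ((ht.eventually_le_atBot T).mono fun n hn => hQ _ hn)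
  have hn2 : 0 < p.n2 := by
    rcases h2.eq_or_lt with h | h
    · rw [← h, zero_mul] at h23
      exact absurd hc h23.not_gt
    · exact h
  have hn3 : 0 < p.n3 := by
    rcases h3.eq_or_lt with h | h
    · rw [← h, mul_zero] at h23
      exact absurd hc h23.not_gt
    · exact h
  refine mem_lrsMinus_of ⟨hn2, hn3, ?_⟩ h0
  have h1 : Tendsto (fun n => 1 - (x (t n)).sigmaSq - ((x (t n)).n2 - (x (t n)).n3) ^ 2) atTop
      (𝓝 (1 - p.sigmaSq - (p.n2 - p.n3) ^ 2)) :=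
    ((((hi 0).pow 2).add ((hi 1).pow 2)).const_sub 1).sub (((hi 2).sub (hi 3)).pow 2)
  refine tendsto_nhds_unique h1 (tendsto_const_nhds.congr fun n => ?_)
  exact (hx.mem (t n)).2.2.symm

theorem alphaLimit_nonempty {v B T : ℝ} {x : ℝ → State} (hx : IsSolution v x)
    (hQ : ∀ t ≤ T, (x t).nProd ≤ B) : (alphaLimit x).Nonempty := by
  have hB : 0 < B := (nProd_pos (hx.mem T)).trans_le (hQ T le_rfl)
  have hmem : ∀ n : ℕ, x (T - n) ∈ Icc (fun _ => -(1 + 4 * B) : State) (fun _ => 1 + 4 * B) := by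
    intro n
    obtain ⟨hX1, hX2⟩ := sigmaPlus_mem (hx.mem (T - n))
    obtain ⟨hY1, hY2⟩ := sigmaMinus_mem (hx.mem (T - n))
    obtain ⟨hM1, hM2⟩ := nMinus_mem (hx.mem (T - n))
    have hP := nPlus_pos (hx.mem (T - n))
    have hQn := hQ (T - n) (by linarith [n.cast_nonneg (α := ℝ)])
    have h2 := (hx.mem (T - n)).1
    have h3 := (hx.mem (T - n)).2.1
    have hPB : (x (T - n)).nPlus ≤ 1 + 4 * B := by
      nlinarith [nPlus_sq (x (T - n))]
    simp only [State.nPlus, State.sigmaPlus, State.sigmaMinus, State.n2, State.n3] at *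
    constructor <;> intro i <;> fin_cases i <;> simp only [Fin.zero_eta, Fin.mk_one,
      Fin.reduceFinMk] <;> linarith
  obtain ⟨p, -, φ, hφ, hp⟩ := isCompact_Icc.tendsto_subseq hmem
  refine ⟨p, fun n => T - (φ n : ℝ), ?_, hp⟩
  exact tendsto_atBot_add_const_left _ T
    (tendsto_neg_atTop_atBot.comp (tendsto_natCast_atTop_atTop.comp hφ.tendsto_atTop))

namespace IsSolution

variable {x : ℝ → State}

theorem tendsto_sigmaPlus_neg_one (hx : IsSolution (1 / 2) x)
    (hlt : ∀ t, (x t).sigmaPlus ^ 2 < 1) :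
    Tendsto (fun t => (x t).sigmaPlus) atBot (𝓝 (-1)) := by
  obtain ⟨σ, hσ, hmono, hle⟩ := hx.exists_tendsto_sigmaPlus (by norm_num) le_rfl
  have hσ1 : -1 ≤ σ := ge_of_tendsto' hσ fun t => (sigmaPlus_mem (hx.mem t)).1
  rcases hσ1.eq_or_lt with h | h
  · rwa [h]
  obtain ⟨c, hc, hQ⟩ := hx.exists_le_nProd le_rfl (by norm_num)
  exact (hx.false_of_averaging (by norm_num) (by norm_num) (a := σ) (b := (x 0).sigmaPlus)
    (T := 0) (z := (1 + σ) ^ 2) h (abs_lt.1 ((sq_lt_one_iff_abs_lt_one _).1 (hlt 0))).2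
    (sqrt_pos.2 hc) (pow_pos (by linarith) 2) (fun t ht => ⟨hle t, hmono ht⟩)
    (fun t ht => hx.nPlus_ge_of_nProd_ge (hQ t ht))
    (fun t _ => pow_le_pow_left₀ (by linarith) (by linarith [hle t]) 2)).elim

/-- Since `2|Σ₋N₋| ≤ 1 - Σ₊² ≤ 2(1 + Σ₊)`, the quantity `u` is of first order in `1 + Σ₊` while `N₊`
is bounded below. -/
theorem abs_crossRatio_mul_le {v c t : ℝ} (hx : IsSolution v x) (h : c ≤ (x t).nPlus) :
    |(x t).crossRatio| * c ≤ 1 + (x t).sigmaPlus := by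
  obtain ⟨hX1, hX2⟩ := sigmaPlus_mem (hx.mem t)
  have h1 := mul_le_mul_of_nonneg_left h (abs_nonneg (x t).crossRatio)
  have h2 : |(x t).crossRatio| * (x t).nPlus = |(x t).sigmaMinus * (x t).nMinus| := by
    rw [← crossRatio_mul_nPlus (hx.mem t), abs_mul, abs_of_pos (nPlus_pos (hx.mem t))]
  have h3 : |(x t).sigmaMinus * (x t).nMinus| ≤ 1 + (x t).sigmaPlus := by
    rw [abs_le]
    constructor <;> nlinarith [hx.constraint t, sq_nonneg ((x t).sigmaMinus + (x t).nMinus),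
      sq_nonneg ((x t).sigmaMinus - (x t).nMinus)]
  linarith

/-- The constant `2√3` makes `N₋²` and `Σ₋²` enter with equal weight, so that the constraint turns
them into `1 - Σ₊²`. The leading term is then of order `(1 + Σ₊)²` and positive. -/
theorem hasDerivAt_one_add_mul (hx : IsSolution (1 / 2) x) (t : ℝ) :
    HasDerivAt (fun t => (1 + (x t).sigmaPlus) * (2 * √3 - (x t).crossRatio))
      (2 * √3 * (1 + (x t).sigmaPlus) ^ 2 * (1 - (x t).sigmaPlus)
        - 4 * (1 + (x t).sigmaPlus) * (x t).nMinus ^ 2 * (x t).crossRatio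
        - 2 * √3 * (1 + (x t).sigmaPlus) * (x t).crossRatio ^ 2) t := by
  refine (((hx.hasDerivAt_sigmaPlus t).const_add 1).mul
    ((hx.hasDerivAt_crossRatio t).const_sub (2 * √3))).congr_deriv ?_
  linear_combination (-2 * √3 * (1 + (x t).sigmaPlus)) * (- hx.constraint t)

/-- With `z = 1 + Σ₊`, the corrected logarithm `L` has derivative at least `-C z²`, and the bounded
function `R` has derivative at least `z²` once `z` is small. So `L + C R` is nondecreasing, hence
bounded above in the past. -/
theorem exists_nProd_le (hx : IsSolution (1 / 2) x)
    (hX : Tendsto (fun t => (x t).sigmaPlus) atBot (𝓝 (-1))) :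
    ∃ T B, ∀ t ≤ T, (x t).nProd ≤ B := by
  obtain ⟨c₀, hc₀, hQ⟩ := hx.exists_le_nProd le_rfl (by norm_num)
  set k := 1 / √c₀ with hk
  have hk0 : 0 < k := by positivity
  have hu : ∀ t ≤ 0, |(x t).crossRatio| ≤ k * (1 + (x t).sigmaPlus) := fun t ht => by
    have := hx.abs_crossRatio_mul_le (hx.nPlus_ge_of_nProd_ge (hQ t ht))
    rwa [hk, div_mul_eq_mul_div, one_mul, le_div_iff₀ (sqrt_pos.2 hc₀)]
  -- `8k` and `4k²` are the coefficients of the cubic errors in the derivative of `R`; the extra `1`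
  -- ensures `z ≤ 1`.
  have hsmall : Tendsto (fun t => (8 * k + 4 * k ^ 2 + 1) * (1 + (x t).sigmaPlus)) atBot (𝓝 0) := by
    simpa using (hX.const_add 1).const_mul (8 * k + 4 * k ^ 2 + 1)
  obtain ⟨T₀, hT₀⟩ := eventually_atBot.1 (hsmall.eventually_lt_const one_pos)
  have hs2 : √3 ≤ 2 := by rw [sqrt_le_left (by norm_num)]; norm_num
  have hs1 : 3 / 2 ≤ √3 := by rw [le_sqrt' (by norm_num)]; norm_num
  -- The three terms bound `2z²`, `2u²` and `(2√3/3) N₋² u` in units of `z²`.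
  set C := 2 + 2 * k ^ 2 + 4 * k with hC
  have hC0 : 0 < C := by positivity
  set T := min T₀ 0
  set L := fun t => log (x t).nProd - 2 * (1 / 2) * √3 / 3 * (x t).crossRatio with hL
  set R := fun t => (1 + (x t).sigmaPlus) * (2 * √3 - (x t).crossRatio) with hR
  refine ⟨T, exp (L T + C * R T + 1), fun t ht => ?_⟩
  rw [← log_le_iff_le_exp (nProd_pos (hx.mem t))]
  have hmono : L t + C * R t ≤ L T + C * R T := by
    refine le_of_deriv_nonneg (f := fun t => L t + C * R t) (fun s _ =>
      (hx.hasDerivAt_log_nProd_sub_crossRatio s).add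
        ((hx.hasDerivAt_one_add_mul s).const_mul C)) (fun s hs => ?_) ht
    have hus := hu s (hs.trans (min_le_right _ _))
    have hTs := hT₀ s (hs.trans (min_le_left _ _))
    obtain ⟨hX1, hX2⟩ := sigmaPlus_mem (hx.mem s)
    have hM : (x s).nMinus ^ 2 ≤ 2 * (1 + (x s).sigmaPlus) := by
      nlinarith [hx.constraint s, sq_nonneg (x s).sigmaMinus]
    have hM0 := sq_nonneg (x s).nMinus
    obtain ⟨z, hz⟩ : ∃ z, z = 1 + (x s).sigmaPlus := ⟨_, rfl⟩
    have hzX : (x s).sigmaPlus = z - 1 := by linarith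
    rw [← hz] at hus hTs hM
    rw [hzX]
    have hz0 : 0 ≤ z := by linarith
    generalize (x s).nMinus ^ 2 = m at *
    generalize (x s).crossRatio = u at *
    have hu2 : u ^ 2 ≤ k ^ 2 * z ^ 2 := by
      rw [← sq_abs u, ← mul_pow]
      exact pow_le_pow_left₀ (abs_nonneg u) hus 2
    have hmu : m * u ≤ 2 * k * z ^ 2 := by
      have h1 : m * u ≤ m * (k * z) :=
        mul_le_mul_of_nonneg_left ((le_abs_self u).trans hus) hM0
      have h2 : m * (k * z) ≤ 2 * z * (k * z) :=
        mul_le_mul_of_nonneg_right hM (by positivity)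
      nlinarith
    have hz1 : z ≤ 1 := by nlinarith [mul_nonneg hk0.le hz0, mul_nonneg (sq_nonneg k) hz0]
    have hR' : z ^ 2 ≤ 2 * √3 * z ^ 2 * (2 - z) - 4 * z * (m * u) - 2 * √3 * z * u ^ 2 := by
      have h1 : 3 * z ^ 2 ≤ 2 * √3 * z ^ 2 * (2 - z) := by
        have h : 3 * (1 : ℝ) ≤ 2 * √3 * (2 - z) := by nlinarith
        nlinarith [sq_nonneg z]
      have h2 : 4 * z * (m * u) ≤ 4 * z * (2 * k * z ^ 2) :=
        mul_le_mul_of_nonneg_left hmu (by positivity)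
      have h3 : 2 * √3 * z * u ^ 2 ≤ 2 * 2 * z * (k ^ 2 * z ^ 2) := by gcongr
      have h4 : (8 * k + 4 * k ^ 2 + 1) * z * z ^ 2 ≤ 1 * z ^ 2 :=
        mul_le_mul_of_nonneg_right hTs.le (sq_nonneg z)
      nlinarith [mul_nonneg hz0 (sq_nonneg z)]
    have hL' : -(C * z ^ 2) ≤ -(2 * z ^ 2) - 2 * u ^ 2 - 2 * √3 / 3 * (m * u) := by
      have h1 : 2 * √3 / 3 * (m * u) ≤ 2 * √3 / 3 * (2 * k * z ^ 2) :=
        mul_le_mul_of_nonneg_left hmu (by positivity)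
      have h2 : 2 * √3 / 3 * (2 * k * z ^ 2) ≤ 2 * (2 * k * z ^ 2) :=
        mul_le_mul_of_nonneg_right (by linarith) (by positivity)
      rw [hC]
      nlinarith
    have := mul_le_mul_of_nonneg_left hR' hC0.le
    nlinarith
  have hRt : 0 ≤ C * R t := by
    refine mul_nonneg hC0.le (mul_nonneg ?_ ?_)
    · linarith [(sigmaPlus_mem (hx.mem t)).1]
    · linarith [(crossRatio_mem (hx.mem t)).2]
  have huT : 2 * (1 / 2) * √3 / 3 * (x t).crossRatio ≤ 1 := by
    have := (crossRatio_mem (hx.mem t)).2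
    nlinarith
  simp only [hL] at hmono ⊢
  linarith

end IsSolution

end LambdaR

/-! ### Polar angles of plane curves -/

namespace LambdaR

section PolarAngle

/-- A nowhere vanishing differentiable plane curve has a polar angle, whose derivative is the
angular velocity. -/
theorem exists_polarAngle {f g f' g' ω : ℝ → ℝ} (hf : ∀ t, HasDerivAt f (f' t) t)
    (hg : ∀ t, HasDerivAt g (g' t) t) (h0 : ∀ t, 0 < f t ^ 2 + g t ^ 2) (hω : Continuous ω)
    (hfg : ∀ t, f t * g' t - g t * f' t = ω t * (f t ^ 2 + g t ^ 2)) :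
    ∃ ψ : ℝ → ℝ, (∀ t, HasDerivAt ψ (ω t) t) ∧
      (∀ t, f t = √(f t ^ 2 + g t ^ 2) * cos (ψ t)) ∧
      ∀ t, g t = √(f t ^ 2 + g t ^ 2) * sin (ψ t) := by
  set z : ℂ := ⟨f 0, g 0⟩
  set ψ : ℝ → ℝ := fun t => Complex.arg z + ∫ s in (0 : ℝ)..t, ω s with hψ
  have hz : ‖z‖ = √(f 0 ^ 2 + g 0 ^ 2) := by
    rw [Complex.norm_def, Complex.normSq_apply, ← sq, ← sq]
  have hψ0 : ψ 0 = Complex.arg z := by simp [hψ]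
  have hf0 : f 0 = √(f 0 ^ 2 + g 0 ^ 2) * cos (ψ 0) := by
    rw [hψ0, ← hz, Complex.norm_mul_cos_arg]
  have hg0 : g 0 = √(f 0 ^ 2 + g 0 ^ 2) * sin (ψ 0) := by
    rw [hψ0, ← hz, Complex.norm_mul_sin_arg]
  have hd : ∀ t, HasDerivAt ψ (ω t) t := fun t =>
    (hω.integral_hasStrictDerivAt 0 t).hasDerivAt.const_add _
  have hA : ∀ t, HasDerivAt (fun t => f t * cos (ψ t) + g t * sin (ψ t))
      (f' t * cos (ψ t) + f t * (-sin (ψ t) * ω t)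
        + (g' t * sin (ψ t) + g t * (cos (ψ t) * ω t))) t := fun t =>
    ((hf t).mul (hd t).cos).add ((hg t).mul (hd t).sin)
  have hB : ∀ t, HasDerivAt (fun t => g t * cos (ψ t) - f t * sin (ψ t))
      (g' t * cos (ψ t) + g t * (-sin (ψ t) * ω t)
        - (f' t * sin (ψ t) + f t * (cos (ψ t) * ω t))) t := fun t =>
    ((hg t).mul (hd t).cos).sub ((hf t).mul (hd t).sin)
  have hr : ∀ t, HasDerivAt (fun t => f t ^ 2 + g t ^ 2)
      (2 * f t * f' t + 2 * g t * g' t) t := fun t =>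
    (((hf t).pow 2).add ((hg t).pow 2)).congr_deriv (by push_cast; ring)
  -- This is the radius times the sine of the angular error. Its square over the squared radius is
  -- constant, since `ψ` turns with the curve, and it vanishes at `0`.
  have hB0 : ∀ t, g t * cos (ψ t) - f t * sin (ψ t) = 0 := by
    have hquot : ∀ t, HasDerivAt
        (fun t => (g t * cos (ψ t) - f t * sin (ψ t)) ^ 2 / (f t ^ 2 + g t ^ 2)) 0 t := fun t => by
      refine (((hB t).pow 2).div (hr t) (h0 t).ne').congr_deriv ?_
      rw [div_eq_zero_iff]
      left
      simp only [Pi.pow_apply]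
      push_cast
      linear_combination (2 * (g t * cos (ψ t) - f t * sin (ψ t)) *
        (f t * cos (ψ t) + g t * sin (ψ t))) * hfg t
    intro t
    have h1 : (g t * cos (ψ t) - f t * sin (ψ t)) ^ 2 / (f t ^ 2 + g t ^ 2)
        = (g 0 * cos (ψ 0) - f 0 * sin (ψ 0)) ^ 2 / (f 0 ^ 2 + g 0 ^ 2) :=
      is_const_of_deriv_eq_zero (fun s => (hquot s).differentiableAt) (fun s => (hquot s).deriv) t 0
    have h2 : g 0 * cos (ψ 0) - f 0 * sin (ψ 0) = 0 := by
      linear_combination cos (ψ 0) * hg0 - sin (ψ 0) * hf0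
    rw [h2, zero_pow two_ne_zero, zero_div, div_eq_zero_iff] at h1
    exact pow_eq_zero_iff two_ne_zero |>.1 (h1.resolve_right (h0 t).ne')
  have hA2 : ∀ t, (f t * cos (ψ t) + g t * sin (ψ t)) ^ 2 = f t ^ 2 + g t ^ 2 := fun t => by
    linear_combination (f t ^ 2 + g t ^ 2) * sin_sq_add_cos_sq (ψ t)
      - (g t * cos (ψ t) - f t * sin (ψ t)) * hB0 t
  -- The error could still be `π`; continuity and the value at `0` exclude this.
  have hA0 : ∀ t, 0 < f t * cos (ψ t) + g t * sin (ψ t) := by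
    have hne : ∀ t, f t * cos (ψ t) + g t * sin (ψ t) ≠ 0 := fun t h => by
      have := h0 t
      rw [← hA2 t, h] at this
      norm_num at this
    have hcont : Continuous fun t => f t * cos (ψ t) + g t * sin (ψ t) :=
      continuous_iff_continuousAt.2 fun t => (hA t).continuousAt
    have h00 : 0 < f 0 * cos (ψ 0) + g 0 * sin (ψ 0) := by
      have : f 0 * cos (ψ 0) + g 0 * sin (ψ 0) = √(f 0 ^ 2 + g 0 ^ 2) := by
        linear_combination cos (ψ 0) * hf0 + sin (ψ 0) * hg0
          + √(f 0 ^ 2 + g 0 ^ 2) * sin_sq_add_cos_sq (ψ 0)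
      rw [this]
      exact sqrt_pos.2 (h0 0)
    intro t
    rcases pos_or_neg_of_ne_zero hcont (T := max t 0) (fun s _ => hne s) with h | h
    · exact h t (le_max_left _ _)
    · exact absurd (h 0 (le_max_right _ _)) h00.not_gt
  have hsqrt : ∀ t, √(f t ^ 2 + g t ^ 2) = f t * cos (ψ t) + g t * sin (ψ t) := fun t => by
    rw [← hA2 t, sqrt_sq (hA0 t).le]
  refine ⟨ψ, hd, fun t => ?_, fun t => ?_⟩ <;> rw [hsqrt]
  · linear_combination -f t * sin_sq_add_cos_sq (ψ t) - sin (ψ t) * hB0 t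
  · linear_combination -g t * sin_sq_add_cos_sq (ψ t) + cos (ψ t) * hB0 t

/-- Two continuous choices of an angle differ by a constant. -/
theorem eq_add_const_of_cos_eq_of_sin_eq {φ ψ : ℝ → ℝ} (hφ : Continuous φ) (hψ : Continuous ψ)
    (hc : ∀ t, cos (φ t) = cos (ψ t)) (hs : ∀ t, sin (φ t) = sin (ψ t)) :
    ∃ c, ∀ t, ψ t = φ t + c := by
  have h1 : ∀ t, ∃ n : ℤ, (n : ℝ) * (2 * π) = ψ t - φ t := fun t => by
    rw [← cos_eq_one_iff, cos_sub, hc, hs]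
    linarith [sin_sq_add_cos_sq (ψ t)]
  choose n hn using h1
  have hcont : Continuous n := by
    rw [Int.isClosedEmbedding_coe_real.isEmbedding.continuous_iff]
    refine ((hψ.sub hφ).div_const (2 * π)).congr fun t => ?_
    rw [Pi.sub_apply, ← hn, mul_div_cancel_right₀ _ (by positivity)]
    rfl
  refine ⟨n 0 * (2 * π), fun t => ?_⟩
  rw [PreconnectedSpace.constant inferInstance hcont (x := 0) (y := t), hn]
  ring

/-- An angle that tends to infinity towards the past passes every direction arbitrarily early. -/
theorem frequently_angle_eq {ψ : ℝ → ℝ} (hψ : Continuous ψ) (h : Tendsto ψ atBot atTop) (α : ℝ) :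
    ∃ᶠ t in atBot, ∃ n : ℕ, ψ t = α + n * (2 * π) := by
  rw [frequently_atBot]
  intro T
  obtain ⟨n, hn⟩ := exists_nat_ge ((ψ T - α) / (2 * π))
  rw [div_le_iff₀ (by positivity)] at hn
  obtain ⟨s, hsT, hs⟩ := ((eventually_le_atBot T).and
    (h.eventually_ge_atTop (α + n * (2 * π)))).exists
  obtain ⟨t, ht, hte⟩ := intermediate_value_Icc' hsT hψ.continuousOn ⟨by linarith, hs⟩
  exact ⟨t, ht.2, n, hte⟩

end PolarAngle

/-! ### The case v > 1/2 -/

namespace IsSolution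

variable {v : ℝ} {x : ℝ → State}

/-- `(1 + 2vΣ₊)²` decreases towards the past to some limit. If this were positive, `1 + 2vΣ₊` would
have a fixed sign, so `Σ₊` would be monotone and trapped between `-1/(2v)` and its value at `T`,
away from `±1`; averaging forbids this. -/
theorem tendsto_sigmaPlus_of_half_lt (hv : 1 / 2 < v) (hv1 : v < 1) (hx : IsSolution v x)
    (hlt : ∀ t, (x t).sigmaPlus ^ 2 < 1) :
    Tendsto (fun t => (x t).sigmaPlus) atBot (𝓝 (-1 / (2 * v))) := by
  have hv0 : 0 < v := by linarith
  have hmono : Monotone fun t => (1 + 2 * v * (x t).sigmaPlus) ^ 2 := fun s t hst =>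
    le_of_deriv_nonneg
      (fun r _ => (((hx.hasDerivAt_sigmaPlus r).const_mul (2 * v)).const_add 1).pow 2)
      (fun r _ => by
        have : 0 ≤ 8 * v * (x r).nMinus ^ 2 * (1 + 2 * v * (x r).sigmaPlus) ^ 2 := by positivity
        refine this.trans_eq ?_
        push_cast
        ring) hst
  have hbdd : BddBelow (range fun t => (1 + 2 * v * (x t).sigmaPlus) ^ 2) :=
    ⟨0, by rintro _ ⟨t, rfl⟩; exact sq_nonneg _⟩
  have hle := ciInf_le hbdd
  have hz := tendsto_atBot_ciInf hmono hbdd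
  set z := ⨅ t, (1 + 2 * v * (x t).sigmaPlus) ^ 2
  have hz0 : 0 ≤ z := ge_of_tendsto' hz fun t => sq_nonneg _
  have hX1 : ∀ t, -1 < (x t).sigmaPlus ∧ (x t).sigmaPlus < 1 := fun t =>
    abs_lt.1 ((sq_lt_one_iff_abs_lt_one _).1 (hlt t))
  rcases hz0.eq_or_lt with h | h
  · rw [← h] at hz
    have h1 : Tendsto (fun t => 1 + 2 * v * (x t).sigmaPlus) atBot (𝓝 0) := by
      rw [tendsto_zero_iff_abs_tendsto_zero]
      simpa only [Function.comp_def, sqrt_sq_eq_abs, sqrt_zero] using hz.sqrt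
    have h2 := (h1.sub_const 1).div_const (2 * v)
    rw [zero_sub] at h2
    refine h2.congr fun t => ?_
    field_simp
    ring
  exfalso
  obtain ⟨T, hT⟩ := eventually_atBot.1 ((hx.tendsto_nProd_atTop hv hv1).eventually_ge_atTop 1)
  have hP : ∀ t ≤ T, √1 ≤ (x t).nPlus := fun t ht => hx.nPlus_ge_of_nProd_ge (hT t ht)
  have hX0 : -1 < -1 / (2 * v) := by
    rw [lt_div_iff₀ (by positivity)]
    linarith
  have hX0' : -1 / (2 * v) < 1 := by
    rw [div_lt_iff₀ (by positivity)]
    linarith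
  have hcont : Continuous fun t => 1 + 2 * v * (x t).sigmaPlus :=
    continuous_const.add (continuous_const.mul hx.continuous_sigmaPlus)
  rcases pos_or_neg_of_ne_zero hcont (T := T) (fun t _ h0 => by
    have := hle t
    simp only [h0] at this
    linarith) with hs | hs
  · have hmX : ∀ t ≤ T, (x t).sigmaPlus ≤ (x T).sigmaPlus := fun t ht =>
      le_of_deriv_nonneg (fun r _ => hx.hasDerivAt_sigmaPlus r)
        (fun r hr => mul_nonneg (by positivity) (hs r hr).le) ht
    refine hx.false_of_averaging hv0 hv1 hX0 (hX1 T).2 (by norm_num) h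
      (fun t ht => ⟨?_, hmX t ht⟩) hP (fun t _ => hle t)
    rw [div_le_iff₀ (by positivity)]
    linarith [hs t ht]
  · have hmX : ∀ t ≤ T, (x T).sigmaPlus ≤ (x t).sigmaPlus := fun t ht =>
      le_of_deriv_nonpos (fun r _ => hx.hasDerivAt_sigmaPlus r)
        (fun r hr => mul_nonpos_of_nonneg_of_nonpos (by positivity) (hs r hr).le) ht
    refine hx.false_of_averaging hv0 hv1 (hX1 T).1 hX0' (by norm_num) h
      (fun t ht => ⟨hmX t ht, ?_⟩) hP (fun t _ => hle t)
    rw [le_div_iff₀ (by positivity)]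
    linarith [hs t ht]

theorem tendsto_nPlus_atTop (hv : 1 / 2 < v) (hv1 : v < 1) (hx : IsSolution v x) :
    Tendsto (fun t => (x t).nPlus) atBot atTop := by
  refine tendsto_atTop.2 fun b => ?_
  filter_upwards [(hx.tendsto_nProd_atTop hv hv1).eventually_ge_atTop (b ^ 2)] with t ht
  exact (le_abs_self b).trans ((sqrt_sq_eq_abs b).ge.trans (hx.nPlus_ge_of_nProd_ge ht))

/-- Off the LRS sets `(Σ₋, N₋)` has a polar angle, with an explicit derivative. -/
theorem exists_isPolarAngle (hx : IsSolution v x) (hlt : ∀ t, (x t).sigmaPlus ^ 2 < 1) :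
    ∃ ψ, IsPolarAngle x ψ ∧ ∀ t, HasDerivAt ψ (-2 * √3 * (x t).nPlus
      - (4 * v + 2 * (x t).sigmaPlus)
        * ((x t).sigmaMinus * (x t).nMinus / (1 - (x t).sigmaPlus ^ 2))) t := by
  have hW : ∀ t, (x t).sigmaMinus ^ 2 + (x t).nMinus ^ 2 = 1 - (x t).sigmaPlus ^ 2 := fun t => by
    linarith [hx.constraint t]
  have hne : ∀ t, 1 - (x t).sigmaPlus ^ 2 ≠ 0 := fun t => (sub_pos.2 (hlt t)).ne'
  have hX := hx.continuous_sigmaPlus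
  have hω : Continuous fun t => -2 * √3 * (x t).nPlus - (4 * v + 2 * (x t).sigmaPlus)
      * ((x t).sigmaMinus * (x t).nMinus / (1 - (x t).sigmaPlus ^ 2)) :=
    (continuous_const.mul hx.continuous_nPlus).sub
      ((continuous_const.add (continuous_const.mul hX)).mul
        ((hx.continuous_sigmaMinus.mul hx.continuous_nMinus).div
          (continuous_const.sub (hX.pow 2)) hne))
  obtain ⟨ψ, hd, hc, hs⟩ := exists_polarAngle hx.hasDerivAt_sigmaMinus hx.hasDerivAt_nMinus
    (fun t => by rw [hW]; exact sub_pos.2 (hlt t)) hω (fun t => by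
      rw [hW, sub_mul, mul_assoc (4 * v + _), div_mul_cancel₀ _ (hne t), ← hW]
      ring)
  simp only [hW] at hc hs
  exact ⟨ψ, ⟨continuous_iff_continuousAt.2 fun t => (hd t).continuousAt, hc, hs⟩, hd⟩

/-- Every polar angle differs by a constant from the explicit one. In the latter's derivative the
quotient is at most `1/2` in size, whereas `N₊ → ∞`. -/
theorem polarAngle_past (hv : 1 / 2 < v) (hv1 : v < 1) (hx : IsSolution v x)
    (hlt : ∀ t, (x t).sigmaPlus ^ 2 < 1) {ψ : ℝ → ℝ} (hψ : IsPolarAngle x ψ) :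
    (∃ T, StrictAntiOn ψ (Iic T)) ∧ Tendsto ψ atBot atTop := by
  obtain ⟨φ, hφ, hd⟩ := hx.exists_isPolarAngle hlt
  have hr : ∀ t, √(1 - (x t).sigmaPlus ^ 2) ≠ 0 := fun t => (sqrt_pos.2 (sub_pos.2 (hlt t))).ne'
  obtain ⟨c, hc⟩ := eq_add_const_of_cos_eq_of_sin_eq hφ.continuous hψ.continuous
    (fun t => mul_left_cancel₀ (hr t) ((hφ.sigmaMinus_eq t).symm.trans (hψ.sigmaMinus_eq t)))
    (fun t => mul_left_cancel₀ (hr t) ((hφ.nMinus_eq t).symm.trans (hψ.nMinus_eq t)))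
  have hdψ := fun t => ((hd t).add_const c).congr_of_eventuallyEq (Eventually.of_forall hc)
  -- `N₊ ≥ 2` makes the main term at most `-4`, and `0 ≤ 4v + 2Σ₊ ≤ 6` limits the other to `3`.
  obtain ⟨T, hT⟩ := eventually_atBot.1 ((hx.tendsto_nPlus_atTop hv hv1).eventually_ge_atTop 2)
  have hle : ∀ t ≤ T, -2 * √3 * (x t).nPlus - (4 * v + 2 * (x t).sigmaPlus)
      * ((x t).sigmaMinus * (x t).nMinus / (1 - (x t).sigmaPlus ^ 2)) ≤ -1 := fun t ht => by
    obtain ⟨hX1, hX2⟩ := sigmaPlus_mem (hx.mem t)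
    have hW := sub_pos.2 (hlt t)
    have h1 : -(1 / 2) ≤ (x t).sigmaMinus * (x t).nMinus / (1 - (x t).sigmaPlus ^ 2) := by
      rw [le_div_iff₀ hW]
      nlinarith [hx.constraint t, sq_nonneg ((x t).sigmaMinus + (x t).nMinus)]
    have hs1 : 1 ≤ √3 := one_le_sqrt.2 (by norm_num)
    have h2 : 1 * 2 ≤ √3 * (x t).nPlus := mul_le_mul hs1 (hT t ht) (by norm_num) (by positivity)
    have h3 := mul_le_mul_of_nonneg_left h1
      (show 0 ≤ 4 * v + 2 * (x t).sigmaPlus by linarith)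
    linarith
  refine ⟨⟨T, strictAntiOn_of_deriv_neg (convex_Iic T) hψ.continuous.continuousOn fun t ht => ?_⟩,
    tendsto_atTop_of_deriv_le one_pos (fun t _ => hdψ t) hle⟩
  rw [interior_Iic] at ht
  rw [(hdψ t).deriv]
  linarith [hle t ht.le]

theorem oscillatesInPast (hv : 1 / 2 < v) (hv1 : v < 1) (hx : IsSolution v x)
    (hlt : ∀ t, (x t).sigmaPlus ^ 2 < 1) :
    OscillatesInPast (fun t => (x t).sigmaMinus) ∧ OscillatesInPast (fun t => (x t).nMinus) := by
  obtain ⟨ψ, hψ, -⟩ := hx.exists_isPolarAngle hlt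
  have hr : ∀ t, 0 < √(1 - (x t).sigmaPlus ^ 2) := fun t => sqrt_pos.2 (sub_pos.2 (hlt t))
  have hfreq := frequently_angle_eq hψ.continuous (hx.polarAngle_past hv hv1 hlt hψ).2
  refine ⟨⟨(hfreq 0).mono ?_, (hfreq π).mono ?_⟩,
    (hfreq (π / 2)).mono ?_, (hfreq (-(π / 2))).mono ?_⟩ <;> rintro t ⟨n, hn⟩ <;>
    beta_reduce
  · rw [hψ.sigmaMinus_eq, hn, cos_add_nat_mul_two_pi, cos_zero, mul_one]
    exact hr t
  · rw [hψ.sigmaMinus_eq, hn, cos_add_nat_mul_two_pi, cos_pi]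
    linarith [hr t]
  · rw [hψ.nMinus_eq, hn, sin_add_nat_mul_two_pi, sin_pi_div_two, mul_one]
    exact hr t
  · rw [hψ.nMinus_eq, hn, sin_add_nat_mul_two_pi, sin_neg, sin_pi_div_two]
    linarith [hr t]

end IsSolution

theorem field_eq_zero_of_mem_lrsMinus {p : State} (hp : p ∈ lrsMinus) :
    field (1 / 2) p = 0 := by
  obtain ⟨h1, h2, h3, -⟩ := hp
  funext i
  fin_cases i <;> simp [field, State.sigmaSq, h1, h2, h3]

end LambdaR

theorem mainTheorem9 (v : ℝ) (hv0 : 0 < v) (hv1 : v < 1) :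
    (v < 1 / 2 →
      (∀ x, LambdaR.IsSolution v x → ¬ range x ⊆ LambdaR.lrsPlus →
        (LambdaR.alphaLimit x).Nonempty ∧
        LambdaR.alphaLimit x ⊆ LambdaR.arcA2 v ∩ LambdaR.arcA3 v) ∧
      LambdaR.IsOrbitWithPastUnboundedN v LambdaR.lrsPlus) ∧
    (v = 1 / 2 →
      (∀ p ∈ LambdaR.lrsMinus, LambdaR.field v p = 0) ∧
      (∀ x, LambdaR.IsSolution v x → ¬ range x ⊆ LambdaR.lrsPlus ∪ LambdaR.lrsMinus →
        (LambdaR.alphaLimit x).Nonempty ∧ LambdaR.alphaLimit x ⊆ LambdaR.lrsMinus) ∧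
      LambdaR.IsOrbitWithPastUnboundedN v LambdaR.lrsPlus) ∧
    (1 / 2 < v →
      (∀ x, LambdaR.IsSolution v x → ¬ range x ⊆ LambdaR.lrsPlus ∪ LambdaR.lrsMinus →
        Tendsto (fun t => (x t).sigmaPlus) atBot (𝓝 (-1 / (2 * v))) ∧
        Tendsto (fun t => (x t).nPlus) atBot atTop ∧
        LambdaR.OscillatesInPast (fun t => (x t).sigmaMinus) ∧
        LambdaR.OscillatesInPast (fun t => (x t).nMinus) ∧
        (∃ ψ, LambdaR.IsPolarAngle x ψ) ∧
        ∀ ψ, LambdaR.IsPolarAngle x ψ →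
          (∃ T, StrictAntiOn ψ (Iic T)) ∧ Tendsto ψ atBot atTop) ∧
      LambdaR.IsOrbitWithPastUnboundedN v LambdaR.lrsPlus ∧
      LambdaR.IsOrbitWithPastUnboundedN v LambdaR.lrsMinus) := by
  have hplus : LambdaR.IsOrbitWithPastUnboundedN v LambdaR.lrsPlus :=
    LambdaR.isOrbitWithPastUnboundedN_lrs hv0 hv1 (one_pow 2) (by linarith)
  refine ⟨fun hv => ⟨fun x hx hlrs => ?_, hplus⟩, fun hv => ?_,
    fun hv => ⟨fun x hx hlrs => ?_, hplus,
      LambdaR.isOrbitWithPastUnboundedN_lrs hv0 hv1 (by norm_num) (by linarith)⟩⟩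
  · obtain ⟨p, hp, hlim⟩ := hx.exists_tendsto_mem_arcs hv0 hv hlrs
    rw [LambdaR.alphaLimit_eq_singleton hlim]
    exact ⟨singleton_nonempty p, singleton_subset_iff.2 hp⟩
  · subst hv
    refine ⟨fun p hp => LambdaR.field_eq_zero_of_mem_lrsMinus hp, fun x hx hlrs => ?_, hplus⟩
    have hX := hx.tendsto_sigmaPlus_neg_one (hx.sq_lt_one_of_not_lrs hv0 hv1 hlrs)
    obtain ⟨c, hc, hQ⟩ := hx.exists_le_nProd le_rfl hv1
    obtain ⟨T, B, hB⟩ := hx.exists_nProd_le hX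
    exact ⟨LambdaR.alphaLimit_nonempty hx hB, LambdaR.alphaLimit_subset_lrsMinus hx hX hc hQ⟩
  · have hlt := hx.sq_lt_one_of_not_lrs hv0 hv1 hlrs
    obtain ⟨ψ, hψ, -⟩ := hx.exists_isPolarAngle hlt
    have hosc := hx.oscillatesInPast hv hv1 hlt
    exact ⟨hx.tendsto_sigmaPlus_of_half_lt hv hv1 hlt, hx.tendsto_nPlus_atTop hv hv1, hosc.1,
      hosc.2, ⟨ψ, hψ⟩, fun φ hφ => hx.polarAngle_past hv hv1 hlt hφ⟩
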